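/- Let $p,q\in\mathbb C$ with $|p|<1$ and $0<|q|<1$. For $z\in\mathbb C\setminus\{0\}$ put $$\theta(z)=\prod_{k=0}^{\infty}(1-zp^k)(1-z^{-1}p^{k+1}),$$ and for a non-negative integer $m$ put $$(a)_m=\prod_{j=0}^{m-1}\theta(aq^j),\qquad (a_1,\dots,a_k)_m=(a_1)_m\cdots(a_k)_m .$$ Let $N_1,\dots,N_n$ be non-negative integers, let $t_1,\dots,t_n,b_1,b_2,b_3$ be non-zero complex numbers, and put $$|N|=N_1+\cdots+N_n,\qquad T=t_1\cdots t_n,\qquad A=qTb_1^{-1}b_2^{-1}b_3^{-1}.$$ Assume that no denominator in the identity below vanishes. Then \begin{align*} \sum_{\lambda} & \prod_{i=1}^n \frac{\theta(Tt_iq^{\lambda_i+|\lambda|})}{\theta(Tt_i)} \prod_{1\leq i<j\leq n} \frac{\theta(q^{\lambda_i-\lambda_j}t_it_j^{-1})}{\theta(t_it_j^{-1})} (q^{1-|N|}A^{-1}t_it_j)_{\lambda_i+\lambda_j} \\ &\qquad \times \prod_{i,j=1}^n \frac{(q^{-N_j}t_it_j^{-1})_{\lambda_i}} {(qt_it_j^{-1},q^{1-|N|}A^{-1}t_it_j)_{\lambda_i}}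 \prod_{j=1}^3 \frac{\prod_{i=1}^n(t_ib_j)_{\lambda_i}} {(qTb_j^{-1})_{|\lambda|}} \\ &\qquad \times \prod_{i=1}^n \frac{(Tt_i,q^{|N|}ATt_i^{-1})_{|\lambda|} \, q^{i\lambda_i}} {(q^{N_i+1}Tt_i)_{|\lambda|} (q^{|N|}ATt_i^{-1})_{|\lambda|-\lambda_i}} \\ &=\prod_{i,j=1}^n \frac{(At_i^{-1}t_j^{-1})_{|N|-N_i}} {(At_i^{-1}t_j^{-1})_{|N|}} \prod_{1\leq i<j\leq n}\frac{(At_i^{-1}t_j^{-1})_{|N|}} {(At_i^{-1}t_j^{-1})_{|N|-N_i-N_j}} \\ & \qquad \times \prod_{i=1}^n\prod_{j=1}^3 \frac{(At_i^{-1}b_j)_{|N|}}{(At_i^{-1}b_j)_{|N|-N_i}} \prod_{i=1}^n(qTt_i)_{N_i} \prod_{j=1}^3 \frac{1}{(qTb_j^{-1})_{|N|}}, \end{align*} where the sum is over all integer vectors $\lambda=(\lambda_1,\dots,\lambda_n)$ with $0\leq \lambda_i\leq N_i$ for each $i$, and $|\lambda|=\lambda_1+\cdots+\lambda_n$. -/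

import Mathlib

/-- The infinite `q`-shifted factorial `(a; p)_∞ = ∏_{k ≥ 0} (1 - a p^k)` (used for `‖p‖ < 1`,
where the product converges absolutely). -/
noncomputable def qPochInf (a p : ℂ) : ℂ :=
  ∏' k : ℕ, (1 - a * p ^ k)

/-- The theta function `θ(z; p) = (z; p)_∞ (p/z; p)_∞`, for `z ≠ 0`. -/
noncomputable def ellTheta (p z : ℂ) : ℂ :=
  qPochInf z p * qPochInf (p / z) p

/-- The elliptic shifted factorial `(a; q, p)_m = ∏_{j=0}^{m-1} θ(a q^j; p)`,
for a non-negative integer `m`. -/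
noncomputable def ellFac (p q a : ℂ) (m : ℕ) : ℂ :=
  ∏ j ∈ Finset.range m, ellTheta p (a * q ^ j)

/-! The multiple series is a specialization of a multiplicity-free identity, a sum over subsets `S`
of a finite set `I` of variables `z_a` (`sum_subsetWeight`). Taking the variables to be `t_i q^k`
with `k < N_i` makes the weight of `S` contain a factor `θ(1) = 0` as soon as `S` contains some `t_i
q^(k+1)` but not `t_i q^k`. The surviving subsets are unions of initial segments, that is, vectors
`λ` with `0 ≤ λ_i ≤ N_i`, and products over them collapse to elliptic factorials.

The subset identity is proved by induction on `|I|` and interpolation in `b₁`, with `β = b₁ b₂` held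
fixed. The functions `b ↦ θ(xb) θ(xβ/b)` all lie in one space of dimension at most two
(`ellTheta_mul_ellTheta_rank_two`, from the Jacobi triple product), so the difference of the two
sides is a binary form of degree `|I|` in two functions of `b`. It suffices to find `|I| + 1`
independent zeros. At `b = 1/z_a` all subsets containing `a` drop out and the identity becomes the
one for `I \ {a}`; at `b = q^|I| T` only `S = I` contributes.

The interpolation needs generic parameters. The summation holds for any non-zero `T`, not only for
the product of the `t_i`, so `T`, `A` and `b₁` can be scaled by powers of a variable `u` while every
`t_i` stays fixed. Only countably many `u` are bad, and continuity at `u = 1` gives the identity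
under the stated non-vanishing conditions alone. -/

section Auxiliary

open Filter Topology

/-! ### Convergence, continuity and zeros of the theta function -/

theorem summable_norm_mul_pow {p : ℂ} (hp : ‖p‖ < 1) (a : ℂ) :
    Summable fun k : ℕ => ‖-(a * p ^ k)‖ := by
  simpa [norm_mul, norm_pow] using
    (summable_geometric_of_lt_one (norm_nonneg p) hp).mul_left ‖a‖

theorem multipliable_one_sub_mul_pow {p : ℂ} (hp : ‖p‖ < 1) (a : ℂ) :
    Multipliable fun k : ℕ => 1 - a * p ^ k := by
  simpa [sub_eq_add_neg] using multipliable_one_add_of_summable (summable_norm_mul_pow hp a)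

theorem qPochInf_eq_mul {p : ℂ} (hp : ‖p‖ < 1) (a : ℂ) :
    qPochInf a p = (1 - a) * qPochInf (a * p) p := by
  have h : (fun k : ℕ => 1 - a * p ^ (k + 1)) = fun k => 1 - a * p * p ^ k := by
    funext k; ring
  have hm : Multipliable fun k : ℕ => 1 - a * p ^ (k + 1) := by
    rw [h]; exact multipliable_one_sub_mul_pow hp (a * p)
  have key : ∏' k : ℕ, (1 - a * p ^ k) = (1 - a * p ^ 0) * ∏' k : ℕ, (1 - a * p ^ (k + 1)) :=
    tprod_eq_zero_mul' hm
  rw [h, pow_zero, mul_one] at key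
  exact key

theorem tendsto_qPochInf {p : ℂ} (hp : ‖p‖ < 1) (a : ℂ) :
    Tendsto (fun n => ∏ k ∈ Finset.range n, (1 - a * p ^ k)) atTop (𝓝 (qPochInf a p)) :=
  (multipliable_one_sub_mul_pow hp a).hasProd.tendsto_prod_nat

theorem qPochInf_ne_zero {p : ℂ} (hp : ‖p‖ < 1) {a : ℂ} (h : ∀ k : ℕ, 1 - a * p ^ k ≠ 0) :
    qPochInf a p ≠ 0 := by
  have := tprod_one_add_ne_zero_of_summable (f := fun k : ℕ => -(a * p ^ k))
    (by simpa [sub_eq_add_neg] using h) (summable_norm_mul_pow hp a)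
  simpa [qPochInf, sub_eq_add_neg] using this

theorem continuous_qPochInf {p : ℂ} (hp : ‖p‖ < 1) : Continuous fun a => qPochInf a p := by
  rw [continuous_iff_continuousAt]
  intro a
  have hS : Summable fun k : ℕ => (‖a‖ + 1) * ‖p‖ ^ k :=
    (summable_geometric_of_lt_one (norm_nonneg p) hp).mul_left _
  have h := (hS.hasProdLocallyUniformlyOn_nat_one_add (f := fun k (x : ℂ) => -(x * p ^ k))
    (K := Metric.ball 0 (‖a‖ + 1)) Metric.isOpen_ball
    (Eventually.of_forall fun k x hx => by
      have : ‖x‖ ≤ ‖a‖ + 1 := by simpa using (Metric.mem_ball.1 hx).le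
      rw [norm_neg, norm_mul, norm_pow]
      gcongr) (fun k => by fun_prop))
  have hc : ContinuousOn (fun x => ∏' k : ℕ, (1 + -(x * p ^ k))) (Metric.ball 0 (‖a‖ + 1)) :=
    h.tendstoLocallyUniformlyOn_finsetRange.continuousOn
      (Eventually.of_forall fun n => by fun_prop).frequently
  have := hc.continuousAt (Metric.isOpen_ball.mem_nhds (x := a) (by simp))
  simpa [qPochInf, sub_eq_add_neg] using this

theorem continuousAt_ellTheta {p : ℂ} (hp : ‖p‖ < 1) {z : ℂ} (hz : z ≠ 0) :
    ContinuousAt (ellTheta p) z := by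
  unfold ellTheta
  have h1 : ContinuousAt (fun z => p / z) z := continuousAt_const.div continuousAt_id hz
  exact (continuous_qPochInf hp).continuousAt.mul
    (ContinuousAt.comp (g := fun a => qPochInf a p) (continuous_qPochInf hp).continuousAt h1)

/-- After the first factors are split off, `θ(z)` and `θ(1/z)` share `(zp;p)_∞ (p/z;p)_∞`, and `1 -
1/z = -(1/z)(1 - z)`. -/
theorem ellTheta_inv {p : ℂ} (hp : ‖p‖ < 1) {z : ℂ} (hz : z ≠ 0) :
    ellTheta p z⁻¹ = -z⁻¹ * ellTheta p z := by
  unfold ellTheta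
  rw [qPochInf_eq_mul hp z, qPochInf_eq_mul hp z⁻¹]
  rw [show p / z⁻¹ = z * p by field_simp, show z⁻¹ * p = p / z by field_simp]
  field_simp
  ring

theorem ellTheta_one {p : ℂ} (hp : ‖p‖ < 1) : ellTheta p 1 = 0 := by
  simp [ellTheta, qPochInf_eq_mul hp 1]

/-- Used to see that the zero set is countable, which is all that the genericity argument requires.
-/
theorem exists_eq_zpow_of_ellTheta_eq_zero {p : ℂ} (hp : ‖p‖ < 1) {z : ℂ} (hz : z ≠ 0)
    (h : ellTheta p z = 0) : ∃ k : ℤ, z = p ^ k := by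
  contrapose! h
  refine mul_ne_zero (qPochInf_ne_zero hp fun k hk => ?_) (qPochInf_ne_zero hp fun k hk => ?_)
  · refine h (-(k : ℤ)) ?_
    rw [zpow_neg, zpow_natCast]
    exact eq_inv_of_mul_eq_one_left (sub_eq_zero.1 hk).symm
  · refine h (k + 1 : ℕ) ?_
    rw [zpow_natCast]
    have := sub_eq_zero.1 hk
    field_simp at this
    rw [this]; ring

theorem ellTheta_inv_ne_zero {p : ℂ} (hp : ‖p‖ < 1) {z : ℂ} (hz : z ≠ 0)
    (h : ellTheta p z ≠ 0) : ellTheta p z⁻¹ ≠ 0 := by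
  rw [ellTheta_inv hp hz]
  exact mul_ne_zero (neg_ne_zero.2 (inv_ne_zero hz)) h

theorem countable_setOf_zpow_eq {e : ℤ} (he : e ≠ 0) (w : ℂ) :
    {u : ℂ | u ≠ 0 ∧ u ^ e = w}.Countable := by
  have key : ∀ (m : ℕ), m ≠ 0 → ∀ w : ℂ, {u : ℂ | u ^ m = w}.Countable := fun m hm w => by
    have : {u : ℂ | u ^ m = w} ⊆ (Polynomial.nthRoots m w).toFinset := fun u hu => by
      simpa [Polynomial.mem_nthRoots (Nat.pos_of_ne_zero hm)] using hu
    exact (Finset.countable_toSet _).mono this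
  rcases Int.natAbs_eq e with h | h
  · refine (key e.natAbs (by simpa using he) w).mono fun u hu => ?_
    have := hu.2
    rw [h, zpow_natCast] at this
    exact this
  · refine (key e.natAbs (by simpa using he) w⁻¹).mono fun u hu => ?_
    have := hu.2
    rw [h, zpow_neg, zpow_natCast] at this
    rw [Set.mem_ofPred_eq, ← this, inv_inv]

/-- The non-zero parameters `u` at which `θ(κ u ^ e)` vanishes form a countable set. -/
theorem countable_ellTheta_zeros {p : ℂ} (hp : ‖p‖ < 1) {κ : ℂ} (hκ : κ ≠ 0) {e : ℤ}
    (he : e ≠ 0) : {u : ℂ | u ≠ 0 ∧ ellTheta p (κ * u ^ e) = 0}.Countable := by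
  have : {u : ℂ | u ≠ 0 ∧ ellTheta p (κ * u ^ e) = 0} ⊆
      ⋃ k : ℤ, {u : ℂ | u ≠ 0 ∧ u ^ e = κ⁻¹ * p ^ k} := fun u hu => by
    obtain ⟨k, hk⟩ := exists_eq_zpow_of_ellTheta_eq_zero hp
      (mul_ne_zero hκ (zpow_ne_zero e hu.1)) hu.2
    refine Set.mem_iUnion.2 ⟨k, hu.1, ?_⟩
    rw [← hk]; field_simp
  exact (Set.countable_iUnion fun k => countable_setOf_zpow_eq he _).mono this

/-! ### Elementary properties of elliptic factorials -/

theorem ellFac_add (p q a : ℂ) (m k : ℕ) :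
    ellFac p q a (m + k) = ellFac p q a m * ellFac p q (a * q ^ m) k := by
  simp [ellFac, Finset.prod_range_add, pow_add, mul_assoc]

theorem ellTheta_ne_zero_of_ellFac {p q a : ℂ} {m : ℕ} (h : ellFac p q a m ≠ 0) {k : ℕ}
    (hk : k < m) : ellTheta p (a * q ^ k) ≠ 0 :=
  Finset.prod_ne_zero_iff.1 h k (Finset.mem_range.2 hk)

theorem ellFac_ne_zero_of_le {p q a : ℂ} {m k : ℕ} (h : ellFac p q a m ≠ 0) (hk : k ≤ m) :
    ellFac p q a k ≠ 0 :=
  Finset.prod_ne_zero_iff.2 fun _ hj =>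
    ellTheta_ne_zero_of_ellFac h ((Finset.mem_range.1 hj).trans_le hk)

theorem continuousAt_ellFac {p q : ℂ} (hp : ‖p‖ < 1) (hq : q ≠ 0) {f : ℂ → ℂ} {u : ℂ}
    (hf : ContinuousAt f u) (h0 : f u ≠ 0) (m : ℕ) :
    ContinuousAt (fun u => ellFac p q (f u) m) u := by
  unfold ellFac
  refine tendsto_finsetProd _ fun j _ => ?_
  have hj : f u * q ^ j ≠ 0 := mul_ne_zero h0 (pow_ne_zero j hq)
  exact ContinuousAt.comp (g := ellTheta p) (continuousAt_ellTheta hp hj)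
    (hf.mul continuousAt_const)

/-! ### The finite and infinite Jacobi triple product -/

/-- The coefficients of `∏ k < N, (1 + x p^k)`. -/
noncomputable def prodCoeff (p : ℂ) : ℕ → ℕ → ℂ
  | 0, 0 => 1
  | 0, _ + 1 => 0
  | _ + 1, 0 => 1
  | N + 1, m + 1 => prodCoeff p N (m + 1) + p ^ N * prodCoeff p N m

/-- The finite product `(p; p)_m`. -/
noncomputable def pPoch (p : ℂ) (m : ℕ) : ℂ := ∏ k ∈ Finset.range m, (1 - p * p ^ k)

theorem pPoch_succ (p : ℂ) (m : ℕ) : pPoch p (m + 1) = pPoch p m * (1 - p ^ (m + 1)) := by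
  rw [pPoch, Finset.prod_range_succ, pow_succ', pPoch]

theorem one_sub_pow_ne_zero {p : ℂ} (hp : ‖p‖ < 1) (k : ℕ) : 1 - p ^ (k + 1) ≠ 0 := by
  intro h
  have h1 : ‖p ^ (k + 1)‖ = 1 := by rw [← sub_eq_zero.1 h, norm_one]
  rw [norm_pow] at h1
  exact (pow_lt_one₀ (norm_nonneg p) hp k.succ_ne_zero).ne h1

theorem pPoch_ne_zero {p : ℂ} (hp : ‖p‖ < 1) (m : ℕ) : pPoch p m ≠ 0 :=
  Finset.prod_ne_zero_iff.2 fun k _ => by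
    rw [← pow_succ']; exact one_sub_pow_ne_zero hp k

theorem prodCoeff_eq_zero (p : ℂ) : ∀ N m, N < m → prodCoeff p N m = 0
  | 0, m + 1, _ => rfl
  | N + 1, m + 1, h => by
    rw [prodCoeff, prodCoeff_eq_zero p N (m + 1) (by omega), prodCoeff_eq_zero p N m (by omega)]
    simp

theorem prod_one_add_mul_pow (p x : ℂ) (N : ℕ) :
    ∏ k ∈ Finset.range N, (1 + x * p ^ k)
      = ∑ m ∈ Finset.range (N + 1), prodCoeff p N m * x ^ m := by
  induction N with
  | zero => simp [prodCoeff]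
  | succ N ih =>
    have h0 : ∀ N, prodCoeff p N 0 = 1 := fun N => by cases N <;> rfl
    have h1 : ∑ m ∈ Finset.range (N + 1), prodCoeff p N (m + 1) * x ^ (m + 1)
        = (∑ m ∈ Finset.range (N + 1), prodCoeff p N m * x ^ m) - 1 := by
      rw [Finset.sum_range_succ, prodCoeff_eq_zero p N (N + 1) (by omega),
        Finset.sum_range_succ' (n := N), h0]
      ring
    rw [Finset.prod_range_succ, ih, Finset.sum_range_succ' (n := N + 1), h0]
    simp only [prodCoeff, add_mul]
    have h2 : (∑ m ∈ Finset.range (N + 1), prodCoeff p N m * x ^ m) * (x * p ^ N)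
        = ∑ m ∈ Finset.range (N + 1), p ^ N * prodCoeff p N m * x ^ (m + 1) := by
      rw [Finset.sum_mul]
      exact Finset.sum_congr rfl fun m _ => by ring
    rw [Finset.sum_add_distrib, h1, ← h2]
    ring

/-- The Gaussian binomial formula with denominators cleared. With `p = r²` the factor `p^(m choose
2)` is `r^(m(m-1))`. The inductive step is the `q`-Pascal rule `1 - p^(m+k+2) = (1 - p^(k+1)) +
p^(k+1) (1 - p^(m+1))`. -/
theorem prodCoeff_mul_pPoch {r : ℂ} (hr : r ≠ 0) : ∀ N m k : ℕ, m + k = N →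
    prodCoeff (r ^ 2) N m * (pPoch (r ^ 2) m * pPoch (r ^ 2) k)
      = r ^ ((m : ℤ) * (m - 1)) * pPoch (r ^ 2) N
  | 0, m, k, h => by
    obtain ⟨rfl, rfl⟩ : m = 0 ∧ k = 0 := by omega
    simp [prodCoeff, pPoch]
  | N + 1, 0, k, h => by
    obtain rfl : k = N + 1 := by omega
    simp [prodCoeff, pPoch]
  | N + 1, m + 1, 0, h => by
    obtain rfl : m = N := by omega
    have ih := prodCoeff_mul_pPoch hr m m 0 (by omega)
    rw [prodCoeff, prodCoeff_eq_zero _ m (m + 1) (by omega), pPoch_succ]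
    have : r ^ (((m + 1 : ℕ) : ℤ) * (((m + 1 : ℕ) : ℤ) - 1))
        = (r ^ 2) ^ m * r ^ ((m : ℤ) * (m - 1)) := by
      rw [← pow_mul, ← zpow_natCast, ← zpow_add₀ hr]; congr 1; push_cast; ring
    rw [this]
    linear_combination ((r ^ 2) ^ m) * (1 - (r ^ 2) ^ (m + 1)) * ih
  | N + 1, m + 1, k + 1, h => by
    have ih1 := prodCoeff_mul_pPoch hr N (m + 1) k (by omega)
    have ih2 := prodCoeff_mul_pPoch hr N m (k + 1) (by omega)
    have h1 : r ^ (((m + 1 : ℕ) : ℤ) * (((m + 1 : ℕ) : ℤ) - 1))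
        = (r ^ 2) ^ m * r ^ ((m : ℤ) * (m - 1)) := by
      rw [← pow_mul, ← zpow_natCast, ← zpow_add₀ hr]; congr 1; push_cast; ring
    rw [h1] at ih1 ⊢
    obtain rfl : N = m + (k + 1) := by omega
    rw [prodCoeff, pPoch_succ _ k] at *
    rw [pPoch_succ _ m] at *
    rw [pPoch_succ _ (m + (k + 1))]
    linear_combination (1 - (r ^ 2) ^ (k + 1)) * ih1
      + (r ^ 2) ^ (m + (k + 1)) * (1 - (r ^ 2) ^ (m + 1)) * ih2

/-- The summand of the theta series `∑ r^(j²) y^j`. -/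
noncomputable def gaussTerm (r y : ℂ) (j : ℤ) : ℂ := r ^ (j * j) * y ^ j

theorem summable_pow_sq_mul_pow {ρ y : ℝ} (h0 : 0 < ρ) (h1 : ρ < 1) (hy : 0 < y) :
    Summable fun n : ℕ => ρ ^ (n * n) * y ^ n := by
  refine summable_of_ratio_test_tendsto_lt_one (l := 0) one_pos
    (Eventually.of_forall fun n => by positivity) ?_
  have h : ∀ n : ℕ, ‖ρ ^ ((n + 1) * (n + 1)) * y ^ (n + 1)‖ / ‖ρ ^ (n * n) * y ^ n‖
      = ρ * y * (ρ ^ 2) ^ n := fun n => by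
    rw [Real.norm_of_nonneg (by positivity), Real.norm_of_nonneg (by positivity),
      div_eq_iff (by positivity)]
    ring
  simp only [h]
  have := (tendsto_pow_atTop_nhds_zero_of_lt_one (r := ρ ^ 2) (by positivity)
    (pow_lt_one₀ h0.le h1 two_ne_zero)).const_mul (ρ * y)
  simpa using this

theorem summable_norm_gaussTerm {r y : ℂ} (hr : r ≠ 0) (h1 : ‖r‖ < 1) (hy : y ≠ 0) :
    Summable fun j => ‖gaussTerm r y j‖ := by
  have h0 := norm_pos_iff.2 hr
  refine Summable.of_nat_of_neg ?_ ?_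
  · refine (summable_pow_sq_mul_pow h0 h1 (norm_pos_iff.2 hy)).congr fun n => ?_
    rw [gaussTerm, norm_mul, norm_zpow, norm_zpow, zpow_natCast, ← Nat.cast_mul, zpow_natCast]
  · refine (summable_pow_sq_mul_pow h0 h1 (inv_pos.2 (norm_pos_iff.2 hy))).congr fun n => ?_
    rw [gaussTerm, norm_mul, norm_zpow, norm_zpow, zpow_neg, zpow_natCast, inv_pow, neg_mul_neg,
      ← Nat.cast_mul, zpow_natCast]

/-- Finite form of the Jacobi triple product, as a sum over all integers. -/
noncomputable def truncTerm (r z : ℂ) (n : ℕ) (j : ℤ) : ℂ :=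
  if |j| ≤ n then
    pPoch (r ^ 2) (2 * n) * (pPoch (r ^ 2) (n + j).toNat)⁻¹ * (pPoch (r ^ 2) (n - j).toNat)⁻¹ *
      gaussTerm r (-z / r) j
  else 0

/-- Expand `∏ (1 + x p^k)` over `k < 2n` at `x = -z/p^n`. The upper half of the factors is
`(z;p)_n`; the lower half, read backwards, is a monomial times `(p/z;p)_n`. Recentring the summation
index by `m = n + j` removes the monomial. -/
theorem prod_range_eq_tsum_truncTerm {r z : ℂ} (hr : r ≠ 0) (h1 : ‖r ^ 2‖ < 1) (hz : z ≠ 0)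
    (n : ℕ) :
    (∏ k ∈ Finset.range n, (1 - z * (r ^ 2) ^ k)) *
      (∏ k ∈ Finset.range n, (1 - r ^ 2 / z * (r ^ 2) ^ k)) = ∑' j, truncTerm r z n j := by
  have e1 := prod_one_add_mul_pow (r ^ 2) (-(z / (r ^ 2) ^ n)) (n + n)
  rw [Finset.prod_range_add] at e1
  have e2 : ∏ k ∈ Finset.range n, (1 + -(z / (r ^ 2) ^ n) * (r ^ 2) ^ (n + k))
      = ∏ k ∈ Finset.range n, (1 - z * (r ^ 2) ^ k) :=
    Finset.prod_congr rfl fun k _ => by rw [pow_add]; field_simp; ring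
  have e3 : ∏ k ∈ Finset.range n, (1 + -(z / (r ^ 2) ^ n) * (r ^ 2) ^ k)
      = ((-z) ^ n * r ^ (-((n : ℤ) * (n + 1)))) *
        ∏ k ∈ Finset.range n, (1 - r ^ 2 / z * (r ^ 2) ^ k) := by
    have e4 : (-z) ^ n * r ^ (-((n : ℤ) * (n + 1)))
        = ∏ k ∈ Finset.range n, (-z * ((r ^ 2) ^ (k + 1))⁻¹) := by
      clear e1 e2
      induction n with
      | zero => simp
      | succ n ih =>
        rw [Finset.prod_range_succ, ← ih, pow_succ, ← pow_mul, ← zpow_natCast r, ← zpow_neg]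
        rw [show -(((n + 1 : ℕ) : ℤ) * (((n + 1 : ℕ) : ℤ) + 1))
          = -((n : ℤ) * (n + 1)) + -((2 * (n + 1) : ℕ) : ℤ) by push_cast; ring, zpow_add₀ hr]
        ring
    rw [e4, ← Finset.prod_mul_distrib, ← Finset.prod_range_reflect]
    refine Finset.prod_congr rfl fun k hk => ?_
    have : (r ^ 2) ^ n = (r ^ 2) ^ (n - 1 - k) * (r ^ 2) ^ (k + 1) := by
      rw [← pow_add]; congr 1; have := Finset.mem_range.1 hk; omega
    rw [this]
    field_simp
    ring
  rw [e2, e3] at e1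
  have hc : (-z) ^ n * r ^ (-((n : ℤ) * (n + 1))) ≠ 0 :=
    mul_ne_zero (pow_ne_zero _ (neg_ne_zero.2 hz)) (zpow_ne_zero _ hr)
  refine mul_left_cancel₀ hc ?_
  rw [show ∀ a b c : ℂ, a * (b * c) = a * c * b from fun a b c => by ring, e1,
    tsum_eq_sum (s := (Finset.range (n + n + 1)).map
      (Nat.castEmbedding.trans (Equiv.subRight (n : ℤ)).toEmbedding)), Finset.sum_map,
    Finset.mul_sum]
  · refine Finset.sum_congr rfl fun m hm => ?_
    have hm' := Finset.mem_range.1 hm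
    have ha : |(m : ℤ) - n| ≤ n := abs_le.2 ⟨by omega, by omega⟩
    have hP := prodCoeff_mul_pPoch hr (n + n) m (n + n - m) (by omega)
    rw [show (Nat.castEmbedding.trans (Equiv.subRight (n : ℤ)).toEmbedding) m = (m : ℤ) - n from rfl,
      truncTerm, if_pos ha,
      show ((n : ℤ) + (m - n)).toNat = m by omega,
      show ((n : ℤ) - (m - n)).toNat = n + n - m by omega, two_mul]
    have p1 := pPoch_ne_zero h1 m
    have p2 := pPoch_ne_zero h1 (n + n - m)
    rw [← eq_div_iff (mul_ne_zero p1 p2)] at hP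
    have hw : -z ≠ 0 := neg_ne_zero.2 hz
    have g1 : gaussTerm r (-z / r) ((m : ℤ) - n) = (-z) ^ m * r ^ ((m : ℤ) * (m - 1)) *
        r ^ (-((2 * n * m : ℕ) : ℤ)) * ((-z) ^ n * r ^ (-((n : ℤ) * (n + 1))))⁻¹ := by
      rw [gaussTerm, div_zpow, zpow_sub₀ hw, zpow_natCast, zpow_natCast, mul_inv, ← zpow_neg,
        div_eq_mul_inv _ (r ^ _), ← zpow_neg, div_eq_mul_inv]
      rw [show (-z) ^ m * r ^ ((m : ℤ) * (m - 1)) * r ^ (-((2 * n * m : ℕ) : ℤ)) *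
        (((-z) ^ n)⁻¹ * r ^ (- -((n : ℤ) * (n + 1)))) = (-z) ^ m * ((-z) ^ n)⁻¹ *
        (r ^ ((m : ℤ) * (m - 1)) * r ^ (-((2 * n * m : ℕ) : ℤ)) *
          r ^ (- -((n : ℤ) * (n + 1)))) by ring, ← zpow_add₀ hr, ← zpow_add₀ hr,
        show ∀ a b c : ℂ, a * (b * c) = b * (a * c) from fun a b c => by ring, ← zpow_add₀ hr]
      congr 2
      push_cast
      ring
    have g2 : (-(z / (r ^ 2) ^ n)) ^ m = (-z) ^ m * r ^ (-((2 * n * m : ℕ) : ℤ)) := by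
      rw [← neg_div, div_pow, ← pow_mul, ← pow_mul, zpow_neg, zpow_natCast, div_eq_mul_inv,
        mul_assoc]
    rw [g1, g2, hP]
    field_simp
  · intro j hj
    rw [truncTerm, if_neg]
    intro h
    have := abs_le.1 h
    refine hj (Finset.mem_map.2 ⟨(j + n).toNat, Finset.mem_range.2 (by omega), ?_⟩)
    change (((j + n).toNat : ℕ) : ℤ) - n = j
    omega

theorem tendsto_pPoch {p : ℂ} (hp : ‖p‖ < 1) :
    Tendsto (pPoch p) atTop (𝓝 (qPochInf p p)) := tendsto_qPochInf hp p

theorem qPochInf_self_ne_zero {p : ℂ} (hp : ‖p‖ < 1) : qPochInf p p ≠ 0 :=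
  qPochInf_ne_zero hp fun k => by rw [← pow_succ']; exact one_sub_pow_ne_zero hp k

/-- The Jacobi triple product identity, with `p = r ^ 2`. -/
theorem ellTheta_eq_tsum {r z : ℂ} (hr : r ≠ 0) (hr1 : ‖r‖ < 1) (hz : z ≠ 0) :
    ellTheta (r ^ 2) z = (qPochInf (r ^ 2) (r ^ 2))⁻¹ * ∑' j, gaussTerm r (-z / r) j := by
  have h1 : ‖r ^ 2‖ < 1 := by
    rw [norm_pow]; exact pow_lt_one₀ (norm_nonneg r) hr1 two_ne_zero
  have hlim := (tendsto_qPochInf h1 z).mul (tendsto_qPochInf h1 (r ^ 2 / z))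
  simp only [prod_range_eq_tsum_truncTerm hr h1 hz] at hlim
  have hP := tendsto_pPoch h1
  have hPi := hP.inv₀ (qPochInf_self_ne_zero h1)
  -- `(p;p)_m` and its inverse converge, hence are bounded, so the finite coefficients are at most
  -- `C * D * D` uniformly in `n` and `j`; this gives a summable dominating series.
  obtain ⟨C, hC⟩ := (Metric.isBounded_range_of_tendsto _ hP).exists_norm_le
  obtain ⟨D, hD⟩ := (Metric.isBounded_range_of_tendsto _ hPi).exists_norm_le
  have hC' : ∀ m, ‖pPoch (r ^ 2) m‖ ≤ C := fun m => hC _ ⟨m, rfl⟩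
  have hD' : ∀ m, ‖(pPoch (r ^ 2) m)⁻¹‖ ≤ D := fun m => hD _ ⟨m, rfl⟩
  have hC0 : 0 ≤ C := (norm_nonneg _).trans (hC' 0)
  have hD0 : 0 ≤ D := (norm_nonneg _).trans (hD' 0)
  have hy : -z / r ≠ 0 := div_ne_zero (neg_ne_zero.2 hz) hr
  have hT := tendsto_tsum_of_dominated_convergence (𝓕 := atTop) (f := truncTerm r z)
    (g := fun j => (qPochInf (r ^ 2) (r ^ 2))⁻¹ * gaussTerm r (-z / r) j)
    ((summable_norm_gaussTerm hr hr1 hy).mul_left (C * D * D)) (fun j => ?_)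
    (Eventually.of_forall fun n j => ?_)
  · rw [tsum_mul_left] at hT
    exact tendsto_nhds_unique hlim hT
  · have hn : ∀ k : ℤ, Tendsto (fun n : ℕ => ((n : ℤ) + k).toNat) atTop atTop := fun k =>
      tendsto_atTop_mono (f := fun n : ℕ => n - k.natAbs) (fun n => by omega)
        (tendsto_sub_atTop_nat _)
    have h2 : Tendsto (fun n : ℕ => 2 * n) atTop atTop :=
      tendsto_atTop_mono (fun n => by simp only [id]; omega) tendsto_id
    have := (((hP.comp h2).mul (hPi.comp (hn j))).mul (hPi.comp (hn (-j)))).mul_const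
      (gaussTerm r (-z / r) j)
    rw [mul_inv_cancel₀ (qPochInf_self_ne_zero h1), one_mul] at this
    refine this.congr' ?_
    filter_upwards [eventually_ge_atTop j.natAbs] with n hn
    rw [truncTerm, if_pos (by rw [Int.abs_eq_natAbs]; exact_mod_cast hn), sub_eq_add_neg]
    rfl
  · rw [truncTerm]
    split_ifs
    · rw [norm_mul, norm_mul, norm_mul]
      gcongr
      · exact hC' _
      · exact hD' _
      · exact hD' _
    · rw [norm_zero]; positivity

/-! ### Theta products of rank two -/

theorem tsum_eq_tsum_add_tsum {α β γ : Type*} {f : γ → ℂ} (hf : Summable f) {e₁ : α → γ}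
    {e₂ : β → γ} (h₁ : Function.Injective e₁) (h₂ : Function.Injective e₂)
    (h : IsCompl (Set.range e₁) (Set.range e₂)) :
    ∑' c, f c = ∑' a, f (e₁ a) + ∑' b, f (e₂ b) := by
  have s₁ : HasSum (f ∘ Subtype.val : Set.range e₁ → ℂ) (∑' a, f (e₁ a)) :=
    h₁.hasSum_range_iff.2 (hf.comp_injective h₁).hasSum
  have s₂ : HasSum (f ∘ Subtype.val : Set.range e₂ → ℂ) (∑' b, f (e₂ b)) :=
    h₂.hasSum_range_iff.2 (hf.comp_injective h₂).hasSum
  exact (s₁.add_isCompl h s₂).tsum_eq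

/-- Splitting the lattice `ℤ²` by the parity of the coordinate sum. -/
theorem tsum_gaussTerm_mul_tsum_gaussTerm {r y w : ℂ} (hr : r ≠ 0) (hr1 : ‖r‖ < 1) (hy : y ≠ 0)
    (hw : w ≠ 0) :
    (∑' j, gaussTerm r y j) * ∑' k, gaussTerm r w k =
      (∑' m, gaussTerm (r ^ 2) (y * w) m) * (∑' l, gaussTerm (r ^ 2) (y / w) l) +
      r * y * ((∑' m, gaussTerm (r ^ 2) (r ^ 2 * (y * w)) m) *
        ∑' l, gaussTerm (r ^ 2) (r ^ 2 * (y / w)) l) := by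
  have hr2 : r ^ 2 ≠ 0 := pow_ne_zero 2 hr
  have h1 : ‖r ^ 2‖ < 1 := by
    rw [norm_pow]; exact pow_lt_one₀ (norm_nonneg r) hr1 two_ne_zero
  have hyw := mul_ne_zero hy hw
  have hyw' := div_ne_zero hy hw
  rw [tsum_mul_tsum_of_summable_norm (summable_norm_gaussTerm hr hr1 hy)
      (summable_norm_gaussTerm hr hr1 hw),
    tsum_mul_tsum_of_summable_norm (summable_norm_gaussTerm hr2 h1 hyw)
      (summable_norm_gaussTerm hr2 h1 hyw'),
    tsum_mul_tsum_of_summable_norm (summable_norm_gaussTerm hr2 h1 (mul_ne_zero hr2 hyw))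
      (summable_norm_gaussTerm hr2 h1 (mul_ne_zero hr2 hyw')), ← tsum_mul_left]
  have hs := summable_mul_of_summable_norm (summable_norm_gaussTerm hr hr1 hy)
      (summable_norm_gaussTerm hr hr1 hw)
  -- Pairs with even sum are `(m+l, m-l)` and those with odd sum `(m+l+1, m-l)`. The sum of squares
  -- becomes `2m² + 2l²` or `2(m²+m) + 2(l²+l) + 1`, so each part factors.
  rw [tsum_eq_tsum_add_tsum hs (e₁ := fun x : ℤ × ℤ => (x.1 + x.2, x.1 - x.2))
    (e₂ := fun x : ℤ × ℤ => (x.1 + x.2 + 1, x.1 - x.2))]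
  · have hz : ∀ {a : ℂ} (e : ℤ), a ≠ 0 → a ^ e ≠ 0 := fun e h => zpow_ne_zero e h
    congr 1
    · refine tsum_congr fun x => ?_
      have hrr : r ^ ((x.1 + x.2) * (x.1 + x.2)) * r ^ ((x.1 - x.2) * (x.1 - x.2))
          = (r ^ 2) ^ (x.1 * x.1) * (r ^ 2) ^ (x.2 * x.2) := by
        rw [← zpow_add₀ hr, ← zpow_natCast r 2, ← zpow_mul, ← zpow_mul, ← zpow_add₀ hr]
        congr 1; push_cast; ring
      simp only [gaussTerm]
      rw [mul_mul_mul_comm, hrr, mul_mul_mul_comm ((r ^ 2) ^ (x.1 * x.1)), zpow_add₀ hy,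
        zpow_sub₀ hw, mul_zpow, div_zpow]
      have := hz x.2 hw
      field_simp
    · refine tsum_congr fun x => ?_
      have hrr : r ^ ((x.1 + x.2 + 1) * (x.1 + x.2 + 1)) * r ^ ((x.1 - x.2) * (x.1 - x.2))
          = r * ((r ^ 2) ^ (x.1 * x.1) * (r ^ 2) ^ x.1 *
            ((r ^ 2) ^ (x.2 * x.2) * (r ^ 2) ^ x.2)) := by
        rw [← zpow_add₀ hr, ← zpow_natCast r 2, ← zpow_mul, ← zpow_mul, ← zpow_mul, ← zpow_mul,
          ← zpow_add₀ hr, ← zpow_add₀ hr, ← zpow_add₀ hr, ← zpow_one_add₀ hr]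
        congr 1; push_cast; ring
      simp only [gaussTerm]
      rw [mul_mul_mul_comm, hrr, zpow_add_one₀ hy, zpow_add₀ hy,
        zpow_sub₀ hw, mul_zpow, mul_zpow, mul_zpow, div_zpow]
      have := hz x.2 hw
      field_simp
  · rintro ⟨a, b⟩ ⟨c, d⟩ h
    simp only [Prod.mk.injEq] at h ⊢
    omega
  · rintro ⟨a, b⟩ ⟨c, d⟩ h
    simp only [Prod.mk.injEq] at h ⊢
    omega
  · refine ⟨?_, ?_⟩
    · rw [Set.disjoint_left]
      rintro _ ⟨⟨a, b⟩, rfl⟩ ⟨⟨c, d⟩, h⟩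
      simp only [Prod.mk.injEq] at h
      omega
    · rw [codisjoint_iff]
      refine Set.eq_univ_of_forall fun ⟨j, k⟩ => ?_
      rcases Int.even_or_odd (j + k) with ⟨m, hm⟩ | ⟨m, hm⟩
      · refine Or.inl ⟨(m, m - k), ?_⟩
        simp only [Prod.mk.injEq]
        omega
      · refine Or.inr ⟨(m, m - k), ?_⟩
        simp only [Prod.mk.injEq]
        omega

/-- For fixed `β`, the functions `b ↦ θ(xb) θ(xβ/b)` span a space of dimension at most two. -/
theorem ellTheta_mul_ellTheta_rank_two {p : ℂ} (hp : ‖p‖ < 1) {β : ℂ} (hβ : β ≠ 0) :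
    ∃ α₀ α₁ h₀ h₁ : ℂ → ℂ, ∀ x b : ℂ, x ≠ 0 → b ≠ 0 →
      ellTheta p (x * b) * ellTheta p (x * β / b) = α₀ x * h₀ b + α₁ x * h₁ b := by
  -- For `p = 0` there is no theta series to use, but `θ(z) = 1 - z` and the claim is seen by
  -- expanding.
  by_cases hp0 : p = 0
  · have h0 : ∀ z : ℂ, ellTheta 0 z = 1 - z := fun z => by
      rw [ellTheta, zero_div, qPochInf_eq_mul (by simp) z, mul_zero]
      simp [qPochInf]
    refine ⟨fun x => 1 + x ^ 2 * β, fun x => -x, fun _ => 1, fun b => b + β / b, ?_⟩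
    intro x b hx hb
    rw [hp0, h0, h0]
    field_simp
    ring
  · obtain ⟨r, rfl⟩ : ∃ r, p = r ^ 2 := by
      obtain ⟨r, h⟩ := IsAlgClosed.exists_pow_nat_eq p (n := 2) two_pos
      exact ⟨r, h.symm⟩
    have hr : r ≠ 0 := by rintro rfl; simp at hp0
    have hr1 : ‖r‖ < 1 := by
      rw [norm_pow] at hp
      exact (pow_lt_one_iff_of_nonneg (norm_nonneg r) two_ne_zero).1 hp
    refine ⟨fun x => (qPochInf (r ^ 2) (r ^ 2))⁻¹ ^ 2 *
        ∑' m, gaussTerm (r ^ 2) (x ^ 2 * β / r ^ 2) m,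
      fun x => -x * (qPochInf (r ^ 2) (r ^ 2))⁻¹ ^ 2 * ∑' m, gaussTerm (r ^ 2) (x ^ 2 * β) m,
      fun b => ∑' m, gaussTerm (r ^ 2) (b ^ 2 / β) m,
      fun b => b * ∑' m, gaussTerm (r ^ 2) (r ^ 2 * (b ^ 2 / β)) m, ?_⟩
    intro x b hx hb
    have hy : -(x * b) / r ≠ 0 := div_ne_zero (neg_ne_zero.2 (mul_ne_zero hx hb)) hr
    have hw : -(x * β / b) / r ≠ 0 :=
      div_ne_zero (neg_ne_zero.2 (div_ne_zero (mul_ne_zero hx hβ) hb)) hr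
    rw [ellTheta_eq_tsum hr hr1 (mul_ne_zero hx hb),
      ellTheta_eq_tsum hr hr1 (div_ne_zero (mul_ne_zero hx hβ) hb), mul_mul_mul_comm,
      tsum_gaussTerm_mul_tsum_gaussTerm hr hr1 hy hw]
    -- The product of the two arguments depends only on `x` and their quotient only on `b`; this
    -- separates the variables in each of the two parity terms.
    have e1 : -(x * b) / r * (-(x * β / b) / r) = x ^ 2 * β / r ^ 2 := by field_simp
    have e2 : -(x * b) / r / (-(x * β / b) / r) = b ^ 2 / β := by field_simp
    have e3 : r ^ 2 * (x ^ 2 * β / r ^ 2) = x ^ 2 * β := by field_simp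
    have e4 : r * (-(x * b) / r) = -(x * b) := by field_simp
    rw [e1, e2, e3, e4]
    ring

/-! ### Binary forms and their zeros -/

open Polynomial in
/-- A function of two variables is a binary form of degree `n` if it is homogeneous of degree `n`
and restricts to a polynomial of degree at most `n` on each line `y = 1 - m x`. -/
def IsBinaryForm (n : ℕ) (Q : ℂ → ℂ → ℂ) : Prop :=
  (∀ c x y, Q (c * x) (c * y) = c ^ n * Q x y) ∧
    ∀ m : ℂ, ∃ P : ℂ[X], P.natDegree ≤ n ∧ ∀ x, P.eval x = Q x (1 - m * x)

namespace IsBinaryForm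

open Polynomial

theorem one : IsBinaryForm 0 fun _ _ => 1 :=
  ⟨fun c x y => by simp, fun m => ⟨1, by simp, by simp⟩⟩

theorem linear (a b : ℂ) : IsBinaryForm 1 fun x y => a * x + b * y :=
  ⟨fun c x y => by ring, fun m => ⟨C (a - b * m) * X + C b, natDegree_linear_le,
    fun x => by simp; ring⟩⟩

theorem mul {n m : ℕ} {Q R : ℂ → ℂ → ℂ} (hQ : IsBinaryForm n Q) (hR : IsBinaryForm m R) :
    IsBinaryForm (n + m) fun x y => Q x y * R x y := by
  refine ⟨fun c x y => by dsimp only; rw [hQ.1, hR.1]; ring, fun μ => ?_⟩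
  obtain ⟨P, hP, hP'⟩ := hQ.2 μ
  obtain ⟨S, hS, hS'⟩ := hR.2 μ
  exact ⟨P * S, natDegree_mul_le_of_le hP hS, fun x => by rw [eval_mul, hP', hS']⟩

theorem const_mul {n : ℕ} {Q : ℂ → ℂ → ℂ} (hQ : IsBinaryForm n Q) (c : ℂ) :
    IsBinaryForm n fun x y => c * Q x y := by
  refine ⟨fun c x y => by dsimp only; rw [hQ.1]; ring, fun μ => ?_⟩
  obtain ⟨P, hP, hP'⟩ := hQ.2 μ
  exact ⟨C c * P, (natDegree_C_mul_le c P).trans hP, fun x => by rw [eval_mul, hP', eval_C]⟩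

theorem sub {n : ℕ} {Q R : ℂ → ℂ → ℂ} (hQ : IsBinaryForm n Q) (hR : IsBinaryForm n R) :
    IsBinaryForm n fun x y => Q x y - R x y := by
  refine ⟨fun c x y => by dsimp only; rw [hQ.1, hR.1]; ring, fun μ => ?_⟩
  obtain ⟨P, hP, hP'⟩ := hQ.2 μ
  obtain ⟨S, hS, hS'⟩ := hR.2 μ
  exact ⟨P - S, (natDegree_sub_le P S).trans (max_le hP hS),
    fun x => by rw [eval_sub, hP', hS']⟩

theorem sum {ι : Type*} (s : Finset ι) {n : ℕ} {Q : ι → ℂ → ℂ → ℂ}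
    (hQ : ∀ i ∈ s, IsBinaryForm n (Q i)) : IsBinaryForm n fun x y => ∑ i ∈ s, Q i x y := by
  refine ⟨fun c x y => ?_, fun μ => ?_⟩
  · rw [Finset.mul_sum]
    exact Finset.sum_congr rfl fun i hi => (hQ i hi).1 c x y
  · choose! P hP hP' using fun i hi => (hQ i hi).2 μ
    refine ⟨∑ i ∈ s, P i, natDegree_sum_le_of_forall_le s P hP, fun x => ?_⟩
    rw [eval_finsetSum]
    exact Finset.sum_congr rfl fun i hi => hP' i hi x

theorem prod {ι : Type*} (s : Finset ι) {Q : ι → ℂ → ℂ → ℂ}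
    (hQ : ∀ i ∈ s, IsBinaryForm 1 (Q i)) :
    IsBinaryForm s.card fun x y => ∏ i ∈ s, Q i x y := by
  classical
  induction s using Finset.induction_on with
  | empty => simpa using one
  | insert a s ha ih =>
    rw [Finset.card_insert_of_notMem ha, add_comm]
    simp only [Finset.prod_insert ha]
    exact (hQ a (Finset.mem_insert_self a s)).mul
      (ih fun i hi => hQ i (Finset.mem_insert_of_mem hi))

/-- A binary form of degree `n` vanishing at more than `n` pairwise non-proportional vectors is
zero. -/
theorem eq_zero {n : ℕ} {Q : ℂ → ℂ → ℂ} (hQ : IsBinaryForm n Q) {κ : Type*} [Fintype κ]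
    (hκ : n < Fintype.card κ) (v w : κ → ℂ) (hv : ∀ i, v i ≠ 0 ∨ w i ≠ 0)
    (hvw : ∀ i j, i ≠ j → v i * w j ≠ v j * w i) (h0 : ∀ i, Q (v i) (w i) = 0) (x y : ℂ) :
    Q x y = 0 := by
  classical
  by_cases hxy : x = 0 ∧ y = 0
  · obtain ⟨i⟩ : Nonempty κ := Fintype.card_pos_iff.1 (by omega)
    have := hQ.1 0 (v i) (w i)
    rw [h0, mul_zero, zero_mul, zero_mul] at this
    rw [hxy.1, hxy.2, this]
  · have hxy' : x ≠ 0 ∨ y ≠ 0 := by tauto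
    -- Choose `m` so that the linear form `y + m x` vanishes neither at the target vector nor at a
    -- node; all of them can then be rescaled to the line `y = 1 - m x`, where the form is a
    -- polynomial of degree at most `n`. Vectors with first coordinate zero need no exclusion, and
    -- `key` treats them separately.
    obtain ⟨m, hm⟩ := Infinite.exists_notMem_finset
      (insert (-y / x) (Finset.univ.image fun i => -w i / v i))
    have key : ∀ a b : ℂ, (a ≠ 0 ∨ b ≠ 0) → m ≠ -b / a → b + m * a ≠ 0 := fun a b hab hne h => by
      by_cases ha : a = 0
      · rw [ha, mul_zero, add_zero] at h; tauto
      · exact hne (by rw [eq_div_iff ha]; linear_combination h)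
    have hm1 : y + m * x ≠ 0 := key x y hxy' fun h => hm (by rw [h]; simp)
    have hm2 : ∀ i, w i + m * v i ≠ 0 := fun i => key _ _ (hv i) fun h => hm (by rw [h]; simp)
    obtain ⟨P, hP, hP'⟩ := hQ.2 m
    have hev : ∀ a b : ℂ, b + m * a ≠ 0 →
        Q a b = (b + m * a) ^ n * P.eval (a / (b + m * a)) := fun a b hab => by
      have e1 : (b + m * a) * (a / (b + m * a)) = a := mul_div_cancel₀ a hab
      have e2 : (b + m * a) * (1 - m * (a / (b + m * a))) = b := by field_simp; ring
      rw [hP', ← hQ.1, e1, e2]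
    have hP0 : P = 0 := by
      refine eq_zero_of_natDegree_lt_card_of_eval_eq_zero P
        (f := fun i => v i / (w i + m * v i)) (fun i j hij => ?_) (fun i => ?_) (by omega)
      · by_contra hne
        rw [div_eq_div_iff (hm2 i) (hm2 j)] at hij
        exact hvw i j hne (by linear_combination hij)
      · have := hev _ _ (hm2 i)
        rw [h0] at this
        exact (mul_eq_zero.1 this.symm).resolve_left (pow_ne_zero n (hm2 i))
    rw [hev x y hm1, hP0, eval_zero, mul_zero]

end IsBinaryForm

/-! ### The subset sum and its values at the interpolation nodes -/

section SubsetSum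

variable {ι : Type*} [LinearOrder ι]

/-- The factor of the subset summand containing the parameter `b`. -/
noncomputable def paramFactor (p q T : ℂ) (z : ι → ℂ) (I S : Finset ι) (b : ℂ) : ℂ :=
  (∏ a ∈ S, ellTheta p (z a * b)) *
    ∏ k ∈ Finset.Ico S.card I.card, ellTheta p (q ^ (k + 1) * T / b)

/-- The product over pairs of `θ(q z_a z_c / B) / θ(z_a z_c / B)`. -/
noncomputable def pairFactor (p q B : ℂ) (z : ι → ℂ) (S : Finset ι) : ℂ :=
  ∏ a ∈ S, ∏ c ∈ S with a < c, ellTheta p (q * (z a * z c / B)) / ellTheta p (z a * z c / B)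

/-- The part of the subset summand independent of the parameters `b`. -/
noncomputable def subsetWeight (p q T B : ℂ) (z : ι → ℂ) (I S : Finset ι) : ℂ :=
  (-1) ^ S.card * (q ^ S.card.choose 2)⁻¹ *
    (∏ a ∈ S, ellTheta p (q ^ S.card * B * T / z a) /
      (ellTheta p (z a ^ 2 / B) * ellTheta p (T * z a * q ^ S.card))) *
    (∏ a ∈ I \ S, (ellTheta p (T * z a * q ^ (S.card + 1)))⁻¹) *
    pairFactor p q B z S *
    ∏ a ∈ S, ∏ c ∈ I \ S, ellTheta p (z a / (q * z c)) / ellTheta p (z a / z c)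

/-- The closed form of the subset sum. -/
noncomputable def subsetValue (p q B : ℂ) (z : ι → ℂ) (I : Finset ι) (b₁ b₂ b₃ : ℂ) : ℂ :=
  (q ^ I.card.choose 2)⁻¹ * pairFactor p q B z I *
    ∏ a ∈ I, -(z a ^ 2 / B) / ellTheta p (z a ^ 2 / B) *
      (ellTheta p (B * b₁ / z a) * ellTheta p (B * b₂ / z a) * ellTheta p (B * b₃ / z a))

theorem ellTheta_div_symm {p : ℂ} (hp : ‖p‖ < 1) {x y : ℂ} (hx : x ≠ 0) (hy : y ≠ 0) :
    ellTheta p (x / y) = -(x / y) * ellTheta p (y / x) := by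
  rw [← inv_div, ellTheta_inv hp (div_ne_zero hy hx)]

theorem prod_prod_lt_insert {M : Type*} [CommMonoid M] {a : ι} {J : Finset ι} (ha : a ∉ J)
    (g : ι → ι → M) (hg : ∀ x y, g x y = g y x) :
    ∏ x ∈ insert a J, ∏ y ∈ insert a J with x < y, g x y
      = (∏ y ∈ J, g a y) * ∏ x ∈ J, ∏ y ∈ J with x < y, g x y := by
  simp only [Finset.prod_filter, Finset.prod_insert ha, lt_irrefl, if_false, one_mul,
    Finset.prod_mul_distrib]
  rw [← mul_assoc, ← Finset.prod_mul_distrib]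
  congr 1
  refine Finset.prod_congr rfl fun y hy => ?_
  have hne : a ≠ y := fun h => ha (h ▸ hy)
  rcases lt_or_gt_of_ne hne with h | h
  · simp [h, h.not_gt]
  · simp [h, h.not_gt, hg y a]

theorem pairFactor_insert (p q B : ℂ) (z : ι → ℂ) {a : ι} {J : Finset ι} (ha : a ∉ J) :
    pairFactor p q B z (insert a J)
      = (∏ c ∈ J, ellTheta p (q * (z a * z c / B)) / ellTheta p (z a * z c / B)) *
        pairFactor p q B z J :=
  prod_prod_lt_insert ha _ fun x y => by rw [mul_comm (z x)]

theorem paramFactor_insert (p q T : ℂ) (z : ι → ℂ) {a : ι} {J S : Finset ι} (ha : a ∉ J)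
    (hS : S ⊆ J) (b : ℂ) :
    paramFactor p q T z (insert a J) S b
      = paramFactor p q T z J S b * ellTheta p (q ^ (J.card + 1) * T / b) := by
  rw [paramFactor, paramFactor, Finset.card_insert_of_notMem ha,
    Finset.prod_Ico_succ_top (Finset.card_le_card hS), mul_assoc]

theorem paramFactor_eq_zero_of_mem {κ : Type*} {p : ℂ} (hp : ‖p‖ < 1) (q T : ℂ) {z : κ → ℂ}
    {a : κ} {I S : Finset κ} (ha : a ∈ S) (hz : z a ≠ 0) : paramFactor p q T z I S (z a)⁻¹ = 0 := by
  rw [paramFactor, Finset.prod_eq_zero ha, zero_mul]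
  rw [mul_inv_cancel₀ hz, ellTheta_one hp]

/-- At `b = 1/z_a` the factors `θ(z_c/z_a)` cancel the denominators of the cross terms with `a`.
What remains, `θ(z_c/(q z_a))`, is the parameter factor at `1/(q z_a)`. The lowest factor `k = |S|`
of the other product cancels the theta function of `T z_a` in the weight. -/
theorem subsetWeight_insert_mul_paramFactor {p q T B : ℂ}
    {z : ι → ℂ} {a : ι} {J S : Finset ι} (ha : a ∉ J) (hS : S ⊆ J)
    (hT : ∀ m : ℕ, ellTheta p (T * z a * q ^ m) ≠ 0)
    (hne : ∀ c ∈ J, ellTheta p (z c / z a) ≠ 0) :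
    subsetWeight p q T B z (insert a J) S * paramFactor p q T z (insert a J) S (z a)⁻¹
      = subsetWeight p q T B z J S * paramFactor p q T z J S (q * z a)⁻¹ := by
  have haS : a ∉ S := fun h => ha (hS h)
  have hsd : insert a J \ S = insert a (J \ S) := by rw [Finset.insert_sdiff_of_notMem _ haS]
  have haJ : a ∉ J \ S := fun h => ha (Finset.sdiff_subset h)
  have e1 : ∏ c ∈ S, ellTheta p (z c * (z a)⁻¹) = ∏ c ∈ S, ellTheta p (z c / z a) :=
    Finset.prod_congr rfl fun c _ => by rw [div_eq_mul_inv]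
  have e2 : ∏ c ∈ S, ellTheta p (z c * (q * z a)⁻¹) = ∏ c ∈ S, ellTheta p (z c / (q * z a)) :=
    Finset.prod_congr rfl fun c _ => by rw [div_eq_mul_inv]
  have e3 : ∏ k ∈ Finset.Ico S.card (J.card + 1), ellTheta p (q ^ (k + 1) * T / (z a)⁻¹)
      = ellTheta p (T * z a * q ^ (S.card + 1)) *
        ∏ k ∈ Finset.Ico S.card J.card, ellTheta p (q ^ (k + 1) * T / (q * z a)⁻¹) := by
    rw [Finset.prod_eq_prod_Ico_succ_bot (Nat.lt_succ_of_le (Finset.card_le_card hS)),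
      ← Finset.prod_Ico_add' _ S.card J.card 1]
    congr 1
    · congr 1
      rw [div_inv_eq_mul]; ring
    · refine Finset.prod_congr rfl fun k _ => ?_
      congr 1
      rw [div_inv_eq_mul, div_inv_eq_mul]; ring
  rw [subsetWeight, subsetWeight, paramFactor, paramFactor, hsd, Finset.prod_insert haJ, e1, e2,
    Finset.card_insert_of_notMem ha, e3]
  simp only [Finset.prod_insert haJ]
  rw [Finset.prod_mul_distrib (f := fun x => ellTheta p (z x / (q * z a)) / ellTheta p (z x / z a)),
    Finset.prod_div_distrib (f := fun x => ellTheta p (z x / (q * z a)))]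
  have h1 : ∏ c ∈ S, ellTheta p (z c / z a) ≠ 0 :=
    Finset.prod_ne_zero_iff.2 fun c hc => hne c (hS hc)
  have h2 := hT (S.card + 1)
  generalize ∏ k ∈ Finset.Ico S.card J.card, ellTheta p (q ^ (k + 1) * T / (q * z a)⁻¹) = X1
  generalize ∏ c ∈ S, ellTheta p (z c / (q * z a)) = X2
  generalize ∏ x ∈ S, ∏ y ∈ J \ S, ellTheta p (z x / (q * z y)) / ellTheta p (z x / z y) = X3
  generalize ∏ x ∈ J \ S, (ellTheta p (T * z x * q ^ (S.card + 1)))⁻¹ = X4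
  generalize ∏ c ∈ S, ellTheta p (z c / z a) = X5 at *
  generalize ellTheta p (T * z a * q ^ (S.card + 1)) = X6 at *
  field_simp

/-- The recursion matching that of the sum. By inversion, the pair factors with `a` turn `θ(B/(z_a
z_c))` into `q θ(B/(q z_a z_c))`; the resulting `q^|J|` is the increment of `q^(|J| choose 2)`. -/
theorem subsetValue_insert {p q B : ℂ} (hp : ‖p‖ < 1) (hq : q ≠ 0) (hB : B ≠ 0)
    {z : ι → ℂ} {a : ι} {J : Finset ι} (ha : a ∉ J) (hz : ∀ c, z c ≠ 0)
    (hne : ∀ c ∈ insert a J, ellTheta p (z a * z c / B) ≠ 0) (b₂ b₃ : ℂ) :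
    subsetValue p q B z (insert a J) (z a)⁻¹ b₂ b₃
      = ellTheta p (B * b₂ / z a) * ellTheta p (B * b₃ / z a) *
        subsetValue p q B z J (q * z a)⁻¹ b₂ b₃ := by
  have hq' : ∀ k : ℕ, q ^ k ≠ 0 := fun k => pow_ne_zero k hq
  have e1 : ∏ c ∈ J, -(z c ^ 2 / B) / ellTheta p (z c ^ 2 / B) *
      (ellTheta p (B * (z a)⁻¹ / z c) * ellTheta p (B * b₂ / z c) * ellTheta p (B * b₃ / z c)) *
      (ellTheta p (q * (z a * z c / B)) / ellTheta p (z a * z c / B))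
      = ∏ c ∈ J, q * (-(z c ^ 2 / B) / ellTheta p (z c ^ 2 / B) *
      (ellTheta p (B * (q * z a)⁻¹ / z c) * ellTheta p (B * b₂ / z c) *
        ellTheta p (B * b₃ / z c))) := by
    refine Finset.prod_congr rfl fun c hc => ?_
    have h0 := hne c (Finset.mem_insert_of_mem hc)
    have hw : z a * z c ≠ 0 := mul_ne_zero (hz a) (hz c)
    have h1 : ellTheta p (B * (z a)⁻¹ / z c) = -(B / (z a * z c)) * ellTheta p (z a * z c / B) := by
      rw [← ellTheta_div_symm hp hB hw]; congr 1; field_simp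
    have h2 : ellTheta p (B * (q * z a)⁻¹ / z c)
        = -(B / (q * (z a * z c))) * ellTheta p (q * (z a * z c / B)) := by
      rw [← mul_div_assoc, ← ellTheta_div_symm hp hB (mul_ne_zero hq hw)]; congr 1; field_simp
    rw [h1, h2]
    have := hz a
    have := hz c
    generalize ellTheta p (z a * z c / B) = Y1 at *
    generalize ellTheta p (q * (z a * z c / B)) = Y2
    generalize ellTheta p (z c ^ 2 / B) = Y3
    field_simp
  rw [Finset.prod_mul_distrib, Finset.prod_mul_distrib (f := fun _ => q), Finset.prod_const] at e1
  have h3 : ellTheta p (B * (z a)⁻¹ / z a) = -(B / z a ^ 2) * ellTheta p (z a ^ 2 / B) := by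
    rw [← ellTheta_div_symm hp hB (pow_ne_zero 2 (hz a))]; congr 1; field_simp
  have h4 : ellTheta p (z a ^ 2 / B) ≠ 0 := by
    have := hne a (Finset.mem_insert_self a J); rwa [← sq] at this
  rw [subsetValue, subsetValue, pairFactor_insert _ _ _ _ ha, Finset.prod_insert ha,
    Finset.card_insert_of_notMem ha, Nat.choose_succ_succ' J.card 1, Nat.choose_one_right, pow_add,
    h3]
  clear h3
  have h5 : -(z a ^ 2 / B) / ellTheta p (z a ^ 2 / B) *
      (-(B / z a ^ 2) * ellTheta p (z a ^ 2 / B) * ellTheta p (B * b₂ / z a) *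
        ellTheta p (B * b₃ / z a)) = ellTheta p (B * b₂ / z a) * ellTheta p (B * b₃ / z a) := by
    have := hz a
    field_simp
  rw [h5]
  generalize (∏ c ∈ J, -(z c ^ 2 / B) / ellTheta p (z c ^ 2 / B) *
      (ellTheta p (B * (z a)⁻¹ / z c) * ellTheta p (B * b₂ / z c) *
        ellTheta p (B * b₃ / z c))) = X at *
  have := hq' J.card
  generalize (∏ c ∈ J, -(z c ^ 2 / B) / ellTheta p (z c ^ 2 / B) *
      (ellTheta p (B * (q * z a)⁻¹ / z c) * ellTheta p (B * b₂ / z c) *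
        ellTheta p (B * b₃ / z c))) = X' at *
  rw [show ∀ q1 q2 P1 P2 E X : ℂ, (q1 * q2)⁻¹ * (P1 * P2) * (E * X) = q1⁻¹ * q2⁻¹ * P2 * E * (X * P1)
    from fun q1 q2 P1 P2 E X => by rw [mul_inv]; ring, e1]
  field_simp

/-- Subsets containing `a` contribute `θ(1) = 0`. For the others, enlarging `J` to `insert a J` adds
only the top factor for `b₂` and for `b₃`. -/
theorem sum_subsetWeight_insert {p q T B : ℂ} (hp : ‖p‖ < 1)
    {z : ι → ℂ} {a : ι} {J : Finset ι} (ha : a ∉ J) (hz : ∀ c, z c ≠ 0)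
    (hT : ∀ m : ℕ, ellTheta p (T * z a * q ^ m) ≠ 0)
    (hne : ∀ c ∈ J, ellTheta p (z c / z a) ≠ 0) (b₂ b₃ : ℂ) :
    ∑ S ∈ (insert a J).powerset, subsetWeight p q T B z (insert a J) S *
        (paramFactor p q T z (insert a J) S (z a)⁻¹ * paramFactor p q T z (insert a J) S b₂ *
          paramFactor p q T z (insert a J) S b₃)
      = ellTheta p (q ^ (J.card + 1) * T / b₂) * ellTheta p (q ^ (J.card + 1) * T / b₃) *
        ∑ S ∈ J.powerset, subsetWeight p q T B z J S *
        (paramFactor p q T z J S (q * z a)⁻¹ * paramFactor p q T z J S b₂ *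
          paramFactor p q T z J S b₃) := by
  rw [Finset.sum_powerset_insert ha, Finset.sum_eq_zero (s := J.powerset)
    (f := fun S => subsetWeight p q T B z (insert a J) (insert a S) * _), add_zero, Finset.mul_sum]
  · refine Finset.sum_congr rfl fun S hS => ?_
    have hS' := Finset.mem_powerset.1 hS
    rw [← mul_assoc, ← mul_assoc, subsetWeight_insert_mul_paramFactor ha hS' hT hne,
      paramFactor_insert _ _ _ _ ha hS', paramFactor_insert _ _ _ _ ha hS']
    ring
  · intro S _
    rw [paramFactor_eq_zero_of_mem hp q T (Finset.mem_insert_self a S) (hz a)]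
    ring

/-- Every proper subset has the factor with index `k = |I| - 1`, which is `θ(1)`. For `S = I`, the
relation `b₂ b₃ B = 1` makes `B b₃/z` the inverse of `z b₂`, and likewise with `b₂`, `b₃` exchanged,
so inversion matches the two sides. -/
theorem sum_subsetWeight_eq_of_top {p q T B : ℂ} (hp : ‖p‖ < 1) (hq : q ≠ 0) (hT0 : T ≠ 0)
    {z : ι → ℂ} {I : Finset ι} (hz : ∀ c, z c ≠ 0)
    (hT : ∀ a ∈ I, ∀ m : ℕ, ellTheta p (T * z a * q ^ m) ≠ 0) {b₂ b₃ : ℂ}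
    (hb : b₂ * b₃ * B = 1) :
    ∑ S ∈ I.powerset, subsetWeight p q T B z I S *
        (paramFactor p q T z I S (q ^ I.card * T) * paramFactor p q T z I S b₂ *
          paramFactor p q T z I S b₃)
      = subsetValue p q B z I (q ^ I.card * T) b₂ b₃ := by
  have hb1 : q ^ I.card * T ≠ 0 := mul_ne_zero (pow_ne_zero _ hq) hT0
  rw [Finset.sum_eq_single I]
  · rw [subsetWeight, subsetValue, paramFactor, paramFactor, paramFactor]
    simp only [Finset.sdiff_self, Finset.prod_empty, Finset.Ico_self, Finset.prod_const_one,
      mul_one]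
    rw [← Finset.prod_mul_distrib, ← Finset.prod_mul_distrib]
    rw [show ∀ s c P Q R : ℂ, s * c * P * Q * R = c * Q * (s * P * R) from
      fun s c P Q R => by ring, ← Finset.prod_const, ← Finset.prod_mul_distrib,
      ← Finset.prod_mul_distrib]
    congr 1
    refine Finset.prod_congr rfl fun a ha => ?_
    have hza := hz a
    have hB : B ≠ 0 := right_ne_zero_of_mul_eq_one hb
    have hb2 : b₂ ≠ 0 := fun h => by simp [h] at hb
    have hb3 : b₃ ≠ 0 := fun h => by simp [h] at hb
    have h2 : ellTheta p (B * b₃ / z a) = -(z a * b₂)⁻¹ * ellTheta p (z a * b₂) := by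
      rw [← ellTheta_inv hp (mul_ne_zero hza hb2)]; congr 1; field_simp; linear_combination hb
    have h3 : ellTheta p (B * b₂ / z a) = -(z a * b₃)⁻¹ * ellTheta p (z a * b₃) := by
      rw [← ellTheta_inv hp (mul_ne_zero hza hb3)]; congr 1; field_simp; linear_combination hb
    have h4 : z a * (q ^ I.card * T) = T * z a * q ^ I.card := by ring
    have h5 : q ^ I.card * B * T / z a = B * (q ^ I.card * T) / z a := by ring
    have h6 := hT a ha I.card
    rw [h2, h3, h4, h5]
    by_cases h0 : ellTheta p (z a ^ 2 / B) = 0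
    · simp [h0]
    · generalize ellTheta p (z a ^ 2 / B) = Y1 at *
      generalize ellTheta p (T * z a * q ^ I.card) = Y2 at *
      generalize ellTheta p (B * (q ^ I.card * T) / z a) = Y3
      field_simp
      linear_combination (-Y3 * ellTheta p (z a * b₂) * ellTheta p (z a * b₃)) * hb
  · intro S hS hne
    have hlt : S.card < I.card := Finset.card_lt_card
      ((Finset.mem_powerset.1 hS).ssubset_of_ne hne)
    have : paramFactor p q T z I S (q ^ I.card * T) = 0 := by
      rw [paramFactor, Finset.prod_eq_zero (i := I.card - 1) (s := Finset.Ico _ _), mul_zero]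
      · exact Finset.mem_Ico.2 ⟨by omega, by omega⟩
      · rw [Nat.sub_add_cancel (by omega), div_self hb1, ellTheta_one hp]
    rw [this]; ring
  · intro h; exact absurd (Finset.mem_powerset_self I) h

end SubsetSum

/-! ### Interpolation and the multiplicity-free identity -/

/-- The linear form with coefficients `α₀`, `α₁` at `x = 1/y_i` vanishes at node `i` because `θ(1) =
0`, and at no other node. Hence the vectors `(h₀, h₁)` at the nodes are non-zero and pairwise
non-proportional. -/
theorem eq_zero_of_interpolation {p β : ℂ} {α₀ α₁ h₀ h₁ : ℂ → ℂ}
    (hr : ∀ x b : ℂ, x ≠ 0 → b ≠ 0 →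
      ellTheta p (x * b) * ellTheta p (x * β / b) = α₀ x * h₀ b + α₁ x * h₁ b)
    (h1 : ellTheta p 1 = 0) {n : ℕ} {Q : ℂ → ℂ → ℂ} (hQ : IsBinaryForm n Q) {κ : Type*}
    [Fintype κ] (hκ : n < Fintype.card κ) (hκ1 : 1 < Fintype.card κ) {y : κ → ℂ}
    (hy : ∀ i, y i ≠ 0)
    (hyy : ∀ i j, i ≠ j → ellTheta p (y j / y i) ≠ 0 ∧ ellTheta p (β / (y i * y j)) ≠ 0)
    (h0 : ∀ i, Q (h₀ (y i)) (h₁ (y i)) = 0) (b : ℂ) : Q (h₀ b) (h₁ b) = 0 := by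
  have hself : ∀ i, α₀ (y i)⁻¹ * h₀ (y i) + α₁ (y i)⁻¹ * h₁ (y i) = 0 := fun i => by
    rw [← hr _ _ (inv_ne_zero (hy i)) (hy i), inv_mul_cancel₀ (hy i), h1, zero_mul]
  have hother : ∀ i j, i ≠ j → α₀ (y i)⁻¹ * h₀ (y j) + α₁ (y i)⁻¹ * h₁ (y j) ≠ 0 :=
    fun i j hij => by
      rw [← hr _ _ (inv_ne_zero (hy i)) (hy j)]
      have := hyy i j hij
      refine mul_ne_zero ?_ ?_
      · rw [inv_mul_eq_div]; exact this.1
      · rw [inv_mul_eq_div, div_div]; exact this.2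
  refine hQ.eq_zero hκ (fun i => h₀ (y i)) (fun i => h₁ (y i)) (fun i => ?_)
    (fun i j hij h => ?_) h0 _ _
  · have : Nontrivial κ := Fintype.one_lt_card_iff_nontrivial.1 hκ1
    obtain ⟨j, hj⟩ := exists_ne i
    by_contra! h
    exact hother j i hj (by rw [h.1, h.2]; ring)
  · have a1 := hself i
    have a2 := hself j
    have b1 := hother i j hij
    have b2 := hother j i hij.symm
    have c1 : h₀ (y i) * (α₀ (y i)⁻¹ * h₀ (y j) + α₁ (y i)⁻¹ * h₁ (y j)) = 0 := by
      linear_combination h₀ (y j) * a1 + α₁ (y i)⁻¹ * h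
    have c2 : h₁ (y i) * (α₀ (y i)⁻¹ * h₀ (y j) + α₁ (y i)⁻¹ * h₁ (y j)) = 0 := by
      linear_combination h₁ (y j) * a1 - α₀ (y i)⁻¹ * h
    have d1 := (mul_eq_zero.1 c1).resolve_right b1
    have d2 := (mul_eq_zero.1 c2).resolve_right b1
    exact b2 (by rw [d1, d2]; ring)

/-- The multiplicity-free case of the summation formula, for generic parameters. -/
theorem sum_subsetWeight {ι : Type*} [LinearOrder ι] {p q T B b₃ : ℂ} (hp : ‖p‖ < 1) (hq : q ≠ 0)
    (hT0 : T ≠ 0) {z : ι → ℂ} (hz : ∀ c, z c ≠ 0) (I : Finset ι)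
    (hne : ∀ a ∈ I, ∀ c ∈ I, a ≠ c → ellTheta p (z a / z c) ≠ 0)
    (hB : ∀ a ∈ I, ∀ c ∈ I, ellTheta p (z a * z c / B) ≠ 0)
    (hT : ∀ a ∈ I, ∀ m : ℕ, ellTheta p (T * z a * q ^ m) ≠ 0)
    (hβ : ∀ a ∈ I, ∀ c ∈ I, ∀ m : ℕ, ellTheta p (q ^ m * T * z a * z c / (B * b₃)) ≠ 0)
    (hβT : ∀ a ∈ I, ellTheta p (z a / (B * b₃)) ≠ 0) (b₁ b₂ : ℂ)
    (hb : b₁ * b₂ * b₃ * B = q ^ I.card * T) :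
    ∑ S ∈ I.powerset, subsetWeight p q T B z I S *
        (paramFactor p q T z I S b₁ * paramFactor p q T z I S b₂ * paramFactor p q T z I S b₃)
      = subsetValue p q B z I b₁ b₂ b₃ := by
  induction hn : I.card generalizing I b₁ b₂ with
  | zero =>
    obtain rfl := Finset.card_eq_zero.1 hn
    simp [subsetWeight, subsetValue, paramFactor, pairFactor]
  | succ n ih =>
    have hb0 : b₁ * b₂ * b₃ * B ≠ 0 := by rw [hb]; exact mul_ne_zero (pow_ne_zero _ hq) hT0
    have hB0 : B ≠ 0 := right_ne_zero_of_mul hb0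
    have hb30 : b₃ ≠ 0 := right_ne_zero_of_mul (left_ne_zero_of_mul hb0)
    have hb20 : b₂ ≠ 0 := right_ne_zero_of_mul (left_ne_zero_of_mul (left_ne_zero_of_mul hb0))
    have hb10 : b₁ ≠ 0 := left_ne_zero_of_mul (left_ne_zero_of_mul (left_ne_zero_of_mul hb0))
    obtain ⟨β, hβdef⟩ : ∃ β, β = b₁ * b₂ := ⟨_, rfl⟩
    have hβ0 : β ≠ 0 := hβdef ▸ mul_ne_zero hb10 hb20
    have hβ' : β * b₃ * B = q ^ I.card * T := by rw [hβdef, hb]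
    have hβ'' : β = q ^ I.card * T / (B * b₃) := by
      rw [eq_div_iff (mul_ne_zero hB0 hb30), ← hβ']; ring
    have hqT : q ^ I.card * T ≠ 0 := mul_ne_zero (pow_ne_zero _ hq) hT0
    obtain ⟨α₀, α₁, h₀, h₁, hr⟩ := ellTheta_mul_ellTheta_rank_two hp hβ0
    -- The difference of the two sides, with each product `θ(xb) θ(xβ/b)` replaced by its linear
    -- form. Here `x` is `z_a`, `q^(k+1) T/β` or `B/z_a`. The term of `S` has `|S|` factors of the
    -- first kind and `|I| - |S|` of the second, so its degree is always `|I|`.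
    set Q : ℂ → ℂ → ℂ := fun X Y =>
      (∑ S ∈ I.powerset, subsetWeight p q T B z I S * paramFactor p q T z I S b₃ *
        ((∏ a ∈ S, (α₀ (z a) * X + α₁ (z a) * Y)) * ∏ k ∈ Finset.Ico S.card I.card,
          (α₀ (q ^ (k + 1) * T / β) * X + α₁ (q ^ (k + 1) * T / β) * Y))) -
      ((q ^ I.card.choose 2)⁻¹ * pairFactor p q B z I *
        ∏ a ∈ I, -(z a ^ 2 / B) / ellTheta p (z a ^ 2 / B) * ellTheta p (B * b₃ / z a)) *
        ∏ a ∈ I, (α₀ (B / z a) * X + α₁ (B / z a) * Y) with hQdef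
    have hform : IsBinaryForm I.card Q := by
      refine IsBinaryForm.sub (IsBinaryForm.sum _ fun S hS => ?_)
        ((IsBinaryForm.prod I fun a _ => IsBinaryForm.linear _ _).const_mul _)
      have := ((IsBinaryForm.prod S fun a _ => IsBinaryForm.linear (α₀ (z a)) (α₁ (z a))).mul
        (IsBinaryForm.prod (Finset.Ico S.card I.card) fun k _ => IsBinaryForm.linear
          (α₀ (q ^ (k + 1) * T / β)) (α₁ (q ^ (k + 1) * T / β)))).const_mul
        (subsetWeight p q T B z I S * paramFactor p q T z I S b₃)
      rwa [Nat.card_Ico, Nat.add_sub_cancel'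
        (Finset.card_le_card (Finset.mem_powerset.1 hS))] at this
    have hQeval : ∀ b, b ≠ 0 → Q (h₀ b) (h₁ b) =
        (∑ S ∈ I.powerset, subsetWeight p q T B z I S * (paramFactor p q T z I S b *
          paramFactor p q T z I S (β / b) * paramFactor p q T z I S b₃)) -
          subsetValue p q B z I b (β / b) b₃ := by
      intro b hb
      rw [hQdef]
      dsimp only
      congr 1
      · refine Finset.sum_congr rfl fun S _ => ?_
        have e1 : ∏ a ∈ S, (α₀ (z a) * h₀ b + α₁ (z a) * h₁ b)
            = (∏ a ∈ S, ellTheta p (z a * b)) * ∏ a ∈ S, ellTheta p (z a * (β / b)) := by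
          rw [← Finset.prod_mul_distrib]
          exact Finset.prod_congr rfl fun a _ => by rw [← hr _ _ (hz a) hb, mul_div_assoc]
        have e2 : ∏ k ∈ Finset.Ico S.card I.card,
            (α₀ (q ^ (k + 1) * T / β) * h₀ b + α₁ (q ^ (k + 1) * T / β) * h₁ b)
            = (∏ k ∈ Finset.Ico S.card I.card, ellTheta p (q ^ (k + 1) * T / b)) *
              ∏ k ∈ Finset.Ico S.card I.card, ellTheta p (q ^ (k + 1) * T / (β / b)) := by
          rw [← Finset.prod_mul_distrib]
          refine Finset.prod_congr rfl fun k _ => ?_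
          rw [← hr _ _ (div_ne_zero (mul_ne_zero (pow_ne_zero _ hq) hT0) hβ0) hb, mul_comm,
            div_mul_cancel₀ _ hβ0, div_mul_eq_mul_div, div_div_eq_mul_div]
        rw [e1, e2]
        simp only [paramFactor]
        ring
      · rw [subsetValue, mul_assoc, ← Finset.prod_mul_distrib]
        congr 1
        refine Finset.prod_congr rfl fun a _ => ?_
        rw [← hr _ _ (div_ne_zero hB0 (hz a)) hb, div_mul_eq_mul_div B (z a) b,
          show B / z a * β / b = B * (β / b) / z a by
            rw [mul_div_assoc, div_mul_eq_mul_div]]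
        ring
    -- The `|I| + 1` nodes: `q^|I| T`, where only `S = I` survives, and the `1/z_a`, where the
    -- induction hypothesis applies.
    let y : Option I → ℂ := fun o => o.elim (q ^ I.card * T) fun a => (z a)⁻¹
    have hy : ∀ i, y i ≠ 0 := by
      rintro (_ | a)
      · exact hqT
      · exact inv_ne_zero (hz a)
    have hcard : Fintype.card (Option I) = I.card + 1 := by simp
    have hyy : ∀ i j, i ≠ j → ellTheta p (y j / y i) ≠ 0 ∧ ellTheta p (β / (y i * y j)) ≠ 0 := by
      have k1 : ∀ a : I, ellTheta p ((z a)⁻¹ / (q ^ I.card * T)) ≠ 0 := fun a => by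
        have := ellTheta_inv_ne_zero hp
          (mul_ne_zero (mul_ne_zero hT0 (hz a)) (pow_ne_zero I.card hq)) (hT a a.2 I.card)
        convert this using 2
        field_simp
      have k2 : ∀ a : I, ellTheta p (β / (q ^ I.card * T * (z a)⁻¹)) ≠ 0 := fun a => by
        convert hβT a a.2 using 2
        rw [hβ'']
        have := hz a
        field_simp
      rintro (_ | a) (_ | c) hij
      · exact absurd rfl hij
      · exact ⟨k1 c, k2 c⟩
      · refine ⟨?_, ?_⟩
        · convert hT a a.2 I.card using 2
          have := hz a
          simp only [y, Option.elim]
          field_simp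
        · have := k2 a
          rwa [mul_comm] at this
      · have hac : a.1 ≠ c.1 := fun h => hij (by rw [Subtype.ext h])
        refine ⟨?_, ?_⟩
        · convert hne a a.2 c c.2 hac using 2
          have := hz a
          have := hz c
          simp only [y, Option.elim]
          field_simp
        · convert hβ a a.2 c c.2 I.card using 2
          have := hz a
          have := hz c
          simp only [y, Option.elim]
          rw [hβ'']
          field_simp
    have hzero : ∀ i, Q (h₀ (y i)) (h₁ (y i)) = 0 := by
      rintro (_ | ⟨a, ha⟩)
      · rw [hQeval _ (hy none), sub_eq_zero]
        refine sum_subsetWeight_eq_of_top hp hq hT0 hz hT ?_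
        change β / (q ^ I.card * T) * b₃ * B = 1
        rw [← hβ']
        field_simp
      · rw [hQeval _ (hy _), sub_eq_zero]
        change ∑ S ∈ I.powerset, subsetWeight p q T B z I S * (paramFactor p q T z I S (z a)⁻¹ *
          paramFactor p q T z I S (β / (z a)⁻¹) * paramFactor p q T z I S b₃) =
          subsetValue p q B z I (z a)⁻¹ (β / (z a)⁻¹) b₃
        have hza := hz a
        obtain ⟨J, haJ, rfl⟩ : ∃ J, a ∉ J ∧ insert a J = I :=
          ⟨I.erase a, Finset.notMem_erase a I, Finset.insert_erase ha⟩
        have hJ : ∀ c ∈ J, c ∈ insert a J := fun c hc => Finset.mem_insert_of_mem hc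
        rw [Finset.card_insert_of_notMem haJ] at hβ' hn
        rw [sum_subsetWeight_insert hp haJ hz (hT a ha) (fun c hc => hne c (hJ c hc) a ha
            fun h => haJ (h ▸ hc)),
          subsetValue_insert hp hq hB0 haJ hz (hB a ha),
          ih J (fun a ha c hc => hne a (hJ a ha) c (hJ c hc))
            (fun a ha c hc => hB a (hJ a ha) c (hJ c hc)) (fun a ha => hT a (hJ a ha))
            (fun a ha c hc => hβ a (hJ a ha) c (hJ c hc)) (fun a ha => hβT a (hJ a ha)) _ _ ?_
            (by omega)]
        -- The second parameter is now `β z_a`. By the balancing relation its prefactor in the sum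
        -- equals the `b₃` prefactor of the value, and conversely, hence the swap.
        · congr 1
          rw [mul_comm]
          congr 2
          · rw [← hβ']; field_simp
          · rw [← hβ']; field_simp
        · rw [pow_succ] at hβ'
          field_simp
          linear_combination hβ'
    have hfin := eq_zero_of_interpolation hr (ellTheta_one hp) hform (by omega) (by omega) hy
      hyy hzero b₁
    rw [hQeval _ hb10, sub_eq_zero] at hfin
    rwa [hβdef, mul_div_cancel_left₀ _ hb10] at hfin

/-! ### Telescoping products -/

section Telescoping

theorem prod_range_div_telescope {φ : ℕ → ℂ} (hφ : ∀ m, φ m ≠ 0) (k b : ℕ) :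
    ∏ l ∈ Finset.range b, φ (k + l + 1) / φ (k + l) = φ (k + b) / φ k := by
  induction b with
  | zero => simp [hφ k]
  | succ b ih =>
    rw [Finset.prod_range_succ, ih, ← add_assoc]
    have := hφ (k + b)
    have := hφ k
    field_simp

theorem prod_range_prod_range_div {φ : ℕ → ℂ} (hφ : ∀ m, φ m ≠ 0) (a b : ℕ) :
    ∏ k ∈ Finset.range a, ∏ l ∈ Finset.range b, φ (k + l + 1) / φ (k + l)
      = (∏ k ∈ Finset.range (a + b), φ k) /
        ((∏ k ∈ Finset.range a, φ k) * ∏ k ∈ Finset.range b, φ k) := by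
  have h : ∀ n, ∏ k ∈ Finset.range n, φ k ≠ 0 := fun n => Finset.prod_ne_zero_iff.2 fun k _ => hφ k
  simp only [prod_range_div_telescope hφ]
  rw [add_comm a b, Finset.prod_range_add, Finset.prod_div_distrib]
  simp only [add_comm b]
  have := h a
  have := h b
  field_simp

/-- The triangular analogue of the rectangle above. Going from `a` to `a + 1` adds a column
telescoping to `φ(2a)/φ(a)` and a diagonal factor `1/φ(2a)`. -/
theorem prod_range_diag_div {φ : ℕ → ℂ} (hφ : ∀ m, φ m ≠ 0) (a : ℕ) :
    (∏ k ∈ Finset.range a, (φ (k + k))⁻¹) * ∏ k ∈ Finset.range a, ∏ l ∈ Finset.range a,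
      (if k < l then φ (k + l + 1) / φ (k + l) else 1) = (∏ k ∈ Finset.range a, φ k)⁻¹ := by
  induction a with
  | zero => simp
  | succ a ih =>
    have h1 : ∏ k ∈ Finset.range (a + 1), ∏ l ∈ Finset.range (a + 1),
        (if k < l then φ (k + l + 1) / φ (k + l) else 1)
        = (∏ k ∈ Finset.range a, ∏ l ∈ Finset.range a,
          (if k < l then φ (k + l + 1) / φ (k + l) else 1)) * (φ (a + a) / φ a) := by
      rw [Finset.prod_range_succ]
      have e1 : ∏ l ∈ Finset.range (a + 1), (if a < l then φ (a + l + 1) / φ (a + l) else 1) = 1 :=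
        Finset.prod_eq_one fun l hl => by
          rw [if_neg]; have := Finset.mem_range.1 hl; omega
      simp only [Finset.prod_range_succ _ a] at e1 ⊢
      rw [e1, mul_one, Finset.prod_mul_distrib]
      congr 1
      rw [← prod_range_div_telescope hφ a a]
      refine Finset.prod_congr rfl fun k hk => ?_
      rw [if_pos (Finset.mem_range.1 hk), add_comm k a]
    rw [h1, Finset.prod_range_succ, Finset.prod_range_succ, mul_inv, ← ih]
    have := hφ (a + a)
    have := hφ a
    field_simp

theorem prod_Ico_div_telescope {ψ : ℤ → ℂ} {b N : ℕ} (h : b ≤ N) (k : ℤ)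
    (hψ : ∀ l : ℕ, b ≤ l → l ≤ N → ψ (k - l) ≠ 0) :
    ∏ l ∈ Finset.Ico b N, ψ (k - l - 1) / ψ (k - l) = ψ (k - N) / ψ (k - b) := by
  induction N, h using Nat.le_induction with
  | base => simp [hψ b le_rfl le_rfl]
  | succ N hbN ih =>
    rw [Finset.prod_Ico_succ_top hbN, ih fun l h1 h2 => hψ l h1 (by omega)]
    have h1 := hψ N hbN (by omega)
    have h2 := hψ b le_rfl (by omega)
    rw [show k - ((N + 1 : ℕ) : ℤ) = k - N - 1 by push_cast; ring]
    field_simp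

/-- Both sides are the product of `ψ` over the integers from `-b` to `a`. -/
theorem prod_range_window (ψ : ℤ → ℂ) (a b : ℕ) :
    (∏ k ∈ Finset.range a, ψ (k - b)) * (∏ k ∈ Finset.range b, ψ (a - k)) * ψ (a - b)
      = ψ 0 * (∏ k ∈ Finset.range a, ψ (k + 1)) * ∏ k ∈ Finset.range b, ψ (-(k + 1)) := by
  have e1 : (∏ k ∈ Finset.range b, ψ (a - k)) * ψ (a - b)
      = ∏ k ∈ Finset.range (b + 1), ψ ((a + k : ℕ) - b) := by
    rw [← Finset.prod_range_succ (fun k => ψ (a - k)), ← Finset.prod_range_reflect]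
    refine Finset.prod_congr rfl fun k hk => ?_
    have := Finset.mem_range.1 hk
    congr 1
    omega
  have e2 : ∏ k ∈ Finset.range b, ψ (-(k + 1)) = ∏ k ∈ Finset.range b, ψ ((k : ℕ) - b) := by
    rw [← Finset.prod_range_reflect]
    refine Finset.prod_congr rfl fun k hk => ?_
    have := Finset.mem_range.1 hk
    congr 1
    omega
  have e3 : ψ 0 * ∏ k ∈ Finset.range a, ψ (k + 1)
      = ∏ k ∈ Finset.range (a + 1), ψ ((b + k : ℕ) - b) := by
    rw [Finset.prod_range_succ', mul_comm]
    congr 1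
    · refine Finset.prod_congr rfl fun k _ => ?_
      congr 1
      push_cast
      ring
    · simp
  rw [mul_assoc, e1, e2, e3, mul_comm _ (∏ k ∈ Finset.range b, _),
    ← Finset.prod_range_add (fun k => ψ ((k : ℕ) - b)) a (b + 1),
    ← Finset.prod_range_add (fun k => ψ ((k : ℕ) - b)) b (a + 1)]
  congr 2
  ring

end Telescoping

/-! ### Reflection and shift identities for elliptic factorials -/

section EllFac

/-- The last `l` factors are read backwards from `γ = α q^(s-1)`; the hypothesis in the form `q γ =
α q^s` also makes sense at `s = 0`. -/
theorem ellFac_eq_mul_prod_div {p q α γ : ℂ} (hq : q ≠ 0) {s l : ℕ} (hl : l ≤ s)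
    (h : q * γ = α * q ^ s) :
    ellFac p q α s = ellFac p q α (s - l) * ∏ k ∈ Finset.range l, ellTheta p (γ / q ^ k) := by
  obtain ⟨m, rfl⟩ := Nat.exists_eq_add_of_le' hl
  rw [Nat.add_sub_cancel, ellFac_add, ellFac, ellFac, ← Finset.prod_range_reflect _ l]
  congr 1
  refine Finset.prod_congr rfl fun k hk => ?_
  have hk := Finset.mem_range.1 hk
  congr 1
  obtain ⟨j, rfl⟩ : ∃ j, l = k + 1 + j := ⟨l - (k + 1), by omega⟩
  rw [eq_div_iff (pow_ne_zero k hq)]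
  refine mul_left_cancel₀ hq ?_
  rw [h, show k + 1 + j - 1 - k = j by omega]
  ring

theorem ellFac_reflect {p q α y γ : ℂ} (hp : ‖p‖ < 1) (hq : q ≠ 0) (hy : y ≠ 0) {s l : ℕ}
    (hl : l ≤ s) (hγ : γ = y⁻¹) (h : q * γ = α * q ^ s) :
    ellFac p q y l * ellFac p q α (s - l)
      = (-y) ^ l * q ^ l.choose 2 * ellFac p q α s := by
  rw [ellFac_eq_mul_prod_div hq hl h, ellFac]
  have : ∏ k ∈ Finset.range l, ellTheta p (y * q ^ k)
      = ((-y) ^ l * q ^ l.choose 2) * ∏ k ∈ Finset.range l, ellTheta p (γ / q ^ k) := by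
    clear hl
    induction l with
    | zero => simp
    | succ l ih =>
      have hyl : y * q ^ l ≠ 0 := mul_ne_zero hy (pow_ne_zero l hq)
      have h1 : ellTheta p (γ / q ^ l) = -(y * q ^ l)⁻¹ * ellTheta p (y * q ^ l) := by
        rw [← ellTheta_inv hp hyl, hγ, mul_inv, div_eq_mul_inv]
      rw [Finset.prod_range_succ, Finset.prod_range_succ, ih, h1, Nat.choose_succ_succ' l 1,
        Nat.choose_one_right, pow_add q]
      have := pow_ne_zero l hq
      generalize ellTheta p (y * q ^ l) = Y
      field_simp
      ring
  rw [this]; ring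

theorem ellFac_neg_self {p q : ℂ} (hp : ‖p‖ < 1) (hq : q ≠ 0) (a : ℕ) :
    ellFac p q (q ^ (-(a : ℤ))) a * q ^ (a + 1).choose 2 = (-1) ^ a * ellFac p q q a := by
  have h : ellFac p q (q ^ (-(a : ℤ))) a = ∏ k ∈ Finset.range a, ellTheta p (q * q ^ k)⁻¹ := by
    rw [ellFac, ← Finset.prod_range_reflect]
    refine Finset.prod_congr rfl fun k hk => ?_
    have hk := Finset.mem_range.1 hk
    rw [← pow_succ', ← zpow_natCast, ← zpow_natCast, ← zpow_add₀ hq, ← zpow_neg]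
    congr 2
    omega
  rw [h, ellFac]
  clear h
  induction a with
  | zero => simp
  | succ a ih =>
    have hqa : q * q ^ a ≠ 0 := mul_ne_zero hq (pow_ne_zero a hq)
    rw [Finset.prod_range_succ, Finset.prod_range_succ, Nat.choose_succ_succ' (a + 1) 1,
      Nat.choose_one_right, pow_add q, ellTheta_inv hp hqa, pow_succ (-1 : ℂ), pow_succ' q a]
    generalize ellTheta p (q * q ^ a) = Y
    rw [show ∀ P c Q R : ℂ, P * (-c * Y) * (Q * R) = (P * R) * (-c * Q * Y) from
      fun P c Q R => by ring, ih]
    field_simp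

/-- After inverting the factors in `x⁻¹`, both sides run through `θ(q^m x)` for `-b ≤ m ≤ a`, as in
`prod_range_window`; the inversions produce the power of `q`. -/
theorem ellFac_pair {p q x : ℂ} (hp : ‖p‖ < 1) (hq : q ≠ 0) (hx : x ≠ 0) (a b : ℕ) :
    ellFac p q (q ^ (-(b : ℤ)) * x) a * ellFac p q (q ^ (-(a : ℤ)) * x⁻¹) b *
        ellTheta p (q ^ ((a : ℤ) - b) * x) * q ^ ((a + 1) * b)
      = ellTheta p x * ellFac p q (q * x) a * ellFac p q (q * x⁻¹) b := by
  have hw := prod_range_window (fun m : ℤ => ellTheta p (q ^ m * x)) a b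
  have e1 : ellFac p q (q ^ (-(b : ℤ)) * x) a
      = ∏ k ∈ Finset.range a, ellTheta p (q ^ ((k : ℤ) - b) * x) :=
    Finset.prod_congr rfl fun k _ => by
      rw [sub_eq_add_neg, zpow_add₀ hq, zpow_natCast]; congr 1; ring
  have e2 : ellFac p q (q * x) a = ∏ k ∈ Finset.range a, ellTheta p (q ^ ((k : ℤ) + 1) * x) :=
    Finset.prod_congr rfl fun k _ => by
      rw [zpow_add_one₀ hq, zpow_natCast]; congr 1; ring
  have e3 : ellFac p q (q ^ (-(a : ℤ)) * x⁻¹) b = (∏ k ∈ Finset.range b, -(q ^ ((a : ℤ) - k) * x)⁻¹)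
      * ∏ k ∈ Finset.range b, ellTheta p (q ^ ((a : ℤ) - k) * x) := by
    rw [← Finset.prod_mul_distrib]
    refine Finset.prod_congr rfl fun k _ => ?_
    rw [← ellTheta_inv hp (mul_ne_zero (zpow_ne_zero _ hq) hx), mul_inv, ← zpow_neg, neg_sub,
      sub_eq_add_neg, zpow_add₀ hq, zpow_natCast]
    congr 1; ring
  have e4 : ellFac p q (q * x⁻¹) b = (∏ k ∈ Finset.range b, -(q ^ (-((k : ℤ) + 1)) * x)⁻¹)
      * ∏ k ∈ Finset.range b, ellTheta p (q ^ (-((k : ℤ) + 1)) * x) := by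
    rw [← Finset.prod_mul_distrib]
    refine Finset.prod_congr rfl fun k _ => ?_
    rw [← ellTheta_inv hp (mul_ne_zero (zpow_ne_zero _ hq) hx), mul_inv, ← zpow_neg, neg_neg,
      zpow_add_one₀ hq, zpow_natCast]
    congr 1; ring
  have e5 : (∏ k ∈ Finset.range b, -(q ^ (-((k : ℤ) + 1)) * x)⁻¹)
      = (∏ k ∈ Finset.range b, -(q ^ ((a : ℤ) - k) * x)⁻¹) * q ^ ((a + 1) * b) := by
    have hc : (q ^ (a + 1)) ^ b = ∏ _k ∈ Finset.range b, q ^ (a + 1) := by simp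
    rw [pow_mul, hc, ← Finset.prod_mul_distrib]
    refine Finset.prod_congr rfl fun k _ => ?_
    have : q ^ ((a : ℤ) - k) = q ^ (-((k : ℤ) + 1)) * q ^ (a + 1) := by
      rw [← zpow_natCast q (a + 1), ← zpow_add₀ hq]; congr 1; push_cast; ring
    rw [this]
    have h1 := zpow_ne_zero (-((k : ℤ) + 1)) hq
    generalize q ^ (-((k : ℤ) + 1)) = Y at *
    field_simp
  simp only [zpow_zero, one_mul] at hw
  rw [e1, e2, e3, e4, e5]
  linear_combination (∏ k ∈ Finset.range b, -(q ^ ((a : ℤ) - k) * x)⁻¹) * q ^ ((a + 1) * b) * hw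

/-- Both sides are `(x)_(s+N+1)`: the extra theta factor fills the gap at exponent `l + s` between
the two ranges. -/
theorem ellFac_shift_window {p q x : ℂ} (s l N : ℕ) (hl : l ≤ N) :
    ellFac p q x s * ((∏ k ∈ Finset.range l, ellTheta p (x * q ^ k * q ^ s)) *
      (∏ k ∈ Finset.Ico l N, ellTheta p (x * q ^ k * q ^ (s + 1)))) *
      ellTheta p (x * q ^ (l + s))
      = ellTheta p x * ellFac p q (q * x) N * ellFac p q (q ^ (N + 1) * x) s := by
  have h1 : (∏ k ∈ Finset.range l, ellTheta p (x * q ^ k * q ^ s)) *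
      (∏ k ∈ Finset.Ico l N, ellTheta p (x * q ^ k * q ^ (s + 1))) * ellTheta p (x * q ^ (l + s))
      = ellFac p q (x * q ^ s) (N + 1) := by
    rw [ellFac, ← Finset.prod_range_mul_prod_Ico _ (show l ≤ N + 1 by omega),
      Finset.prod_eq_prod_Ico_succ_bot (show l < N + 1 by omega), ← Finset.prod_Ico_add' _ l N 1]
    have e1 : ∏ k ∈ Finset.range l, ellTheta p (x * q ^ k * q ^ s)
        = ∏ k ∈ Finset.range l, ellTheta p (x * q ^ s * q ^ k) :=
      Finset.prod_congr rfl fun k _ => by congr 1; ring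
    have e2 : ∏ k ∈ Finset.Ico l N, ellTheta p (x * q ^ k * q ^ (s + 1))
        = ∏ k ∈ Finset.Ico l N, ellTheta p (x * q ^ s * q ^ (k + 1)) :=
      Finset.prod_congr rfl fun k _ => by congr 1; ring
    rw [e1, e2, show x * q ^ (l + s) = x * q ^ s * q ^ l by ring]
    ring
  have h2 : ellTheta p x * ellFac p q (q * x) N = ellFac p q x (N + 1) := by
    rw [add_comm N 1, ellFac_add]
    simp [ellFac, mul_comm]
  rw [mul_assoc, h1, h2, ← ellFac_add, mul_comm (q ^ (N + 1)), ← ellFac_add, add_comm]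

end EllFac

/-! ### Unions of initial segments and the bookkeeping of powers of `q` -/

section Blocks

variable {n : ℕ}

/-- The disjoint union of the initial segments `{(i, k) : k < l i}`. -/
def blockSet (l : Fin n → ℕ) : Finset (Fin n ×ₗ ℕ) :=
  (Finset.univ.sigma fun i => Finset.range (l i)).map
    ⟨fun x => toLex (x.1, x.2), fun x y h => by
      have h' : (x.1, x.2) = (y.1, y.2) := toLex.injective h
      rw [Prod.mk.injEq] at h'
      exact Sigma.ext h'.1 (heq_of_eq h'.2)⟩

/-- The variables `t_i q^k`. -/
noncomputable def blockVar (q : ℂ) (t : Fin n → ℂ) (x : Fin n ×ₗ ℕ) : ℂ :=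
  t (ofLex x).1 * q ^ (ofLex x).2

theorem mem_blockSet {l : Fin n → ℕ} {x : Fin n ×ₗ ℕ} :
    x ∈ blockSet l ↔ (ofLex x).2 < l (ofLex x).1 := by
  simp only [blockSet, Finset.mem_map, Finset.mem_sigma, Finset.mem_univ, true_and,
    Finset.mem_range]
  constructor
  · rintro ⟨⟨i, k⟩, h, rfl⟩; exact h
  · intro h; exact ⟨⟨(ofLex x).1, (ofLex x).2⟩, h, rfl⟩

theorem prod_blockSet (l : Fin n → ℕ) (f : Fin n ×ₗ ℕ → ℂ) :
    ∏ x ∈ blockSet l, f x = ∏ i, ∏ k ∈ Finset.range (l i), f (toLex (i, k)) := by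
  rw [blockSet, Finset.prod_map, Finset.prod_sigma]
  rfl

theorem card_blockSet (l : Fin n → ℕ) : (blockSet l).card = ∑ i, l i := by
  simp [blockSet]

theorem prod_blockSet_sdiff {l N : Fin n → ℕ} (f : Fin n ×ₗ ℕ → ℂ) :
    ∏ x ∈ blockSet N \ blockSet l, f x
      = ∏ i, ∏ k ∈ Finset.Ico (l i) (N i), f (toLex (i, k)) := by
  rw [Finset.prod_sigma']
  refine (Finset.prod_bij (fun x _ => toLex (x.1, x.2)) ?_ ?_ ?_ ?_).symm
  · rintro ⟨i, k⟩ h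
    have h' := Finset.mem_Ico.1 (Finset.mem_sigma.1 h).2
    exact Finset.mem_sdiff.2 ⟨mem_blockSet.2 h'.2, fun h2 => (mem_blockSet.1 h2).not_ge h'.1⟩
  · rintro ⟨i, k⟩ _ ⟨j, m⟩ _ h
    have h' : (i, k) = (j, m) := toLex.injective h
    rw [Prod.mk.injEq] at h'
    exact Sigma.ext h'.1 (heq_of_eq h'.2)
  · intro x hx
    have h' := Finset.mem_sdiff.1 hx
    exact ⟨⟨(ofLex x).1, (ofLex x).2⟩, Finset.mem_sigma.2 ⟨Finset.mem_univ _, Finset.mem_Ico.2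
      ⟨not_lt.1 fun h => h'.2 (mem_blockSet.2 h), mem_blockSet.1 h'.1⟩⟩, rfl⟩
  · intro _ _; rfl

theorem blockSet_subset {l N : Fin n → ℕ} (h : l ≤ N) : blockSet l ⊆ blockSet N := fun _ hx =>
  mem_blockSet.2 ((mem_blockSet.1 hx).trans_le (h _))

theorem blockSet_injective : Function.Injective (blockSet : (Fin n → ℕ) → _) := by
  intro l m h
  funext i
  have key : ∀ k, k < l i ↔ k < m i := fun k => by
    have := mem_blockSet (l := l) (x := toLex (i, k))
    rw [h, mem_blockSet] at this
    exact this.symm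
  exact le_antisymm (not_lt.1 fun h => lt_irrefl _ ((key _).1 h))
    (not_lt.1 fun h => lt_irrefl _ ((key _).2 h))

/-- A sum over subsets of a block set supported on unions of initial segments. -/
theorem sum_powerset_blockSet (N : Fin n → ℕ) (f : Finset (Fin n ×ₗ ℕ) → ℂ)
    (hf : ∀ S ⊆ blockSet N, ∀ i k, toLex (i, k + 1) ∈ S → toLex (i, k) ∉ S → f S = 0) :
    ∑ S ∈ (blockSet N).powerset, f S = ∑ l ∈ Finset.Icc (0 : Fin n → ℕ) N, f (blockSet l) := by
  rw [← Finset.sum_image (f := f) (g := blockSet) (s := Finset.Icc (0 : Fin n → ℕ) N)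
    fun _ _ _ _ h => blockSet_injective h]
  refine (Finset.sum_subset ?_ ?_).symm
  · intro S hS
    obtain ⟨l, hl, rfl⟩ := Finset.mem_image.1 hS
    exact Finset.mem_powerset.2 (blockSet_subset (Finset.mem_Icc.1 hl).2)
  · intro S hS hS'
    by_contra hne
    have hsub := Finset.mem_powerset.1 hS
    have hdown : ∀ i k, toLex (i, k + 1) ∈ S → toLex (i, k) ∈ S := fun i k h => by
      by_contra h'; exact hne (hf S hsub i k h h')
    have hN : ∀ i, toLex (i, N i) ∉ S := fun i h => lt_irrefl _ (mem_blockSet.1 (hsub h))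
    have hex : ∀ i, ∃ k, toLex (i, k) ∉ S := fun i => ⟨N i, hN i⟩
    classical
    -- The length of segment `i` is the least `k` with `(i, k)` outside `S`; downward closure then
    -- says that `S` has no later elements in that row.
    refine hS' (Finset.mem_image.2 ⟨fun i => Nat.find (hex i), Finset.mem_Icc.2
      ⟨fun i => Nat.zero_le _, fun i => Nat.find_min' (hex i) (hN i)⟩, ?_⟩)
    ext x
    rw [mem_blockSet]
    refine ⟨fun h => not_not.1 (Nat.find_min (hex _) h), fun h => ?_⟩
    by_contra hle
    have hmono : ∀ m k, toLex ((ofLex x).1, k + m) ∈ S → toLex ((ofLex x).1, k) ∈ S := fun m => by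
      induction m with
      | zero => exact fun k h => h
      | succ m ih => exact fun k h => ih k (hdown _ _ h)
    obtain ⟨m, hm⟩ := Nat.exists_eq_add_of_le (not_lt.1 hle)
    refine Nat.find_spec (hex (ofLex x).1) (hmono m _ ?_)
    rw [← hm]
    exact h

theorem prod_prod_eq_diag_mul (f : Fin n → Fin n → ℂ) :
    ∏ i, ∏ j, f i j = (∏ i, f i i) * ∏ i, ∏ j ∈ Finset.Ioi i, f i j * f j i := by
  have h := Finset.prod_prod_Ioi_mul_eq_prod_prod_off_diag fun i j => f j i
  rw [h, ← Finset.prod_mul_distrib]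
  refine Finset.prod_congr rfl fun i _ => ?_
  rw [← Finset.prod_mul_prod_compl {i}, Finset.prod_singleton]

theorem choose_two_add (a b : ℕ) : (a + b).choose 2 = a.choose 2 + b.choose 2 + a * b := by
  induction b with
  | zero => simp
  | succ b ih =>
    rw [← add_assoc, Nat.choose_succ_succ' _ 1, Nat.choose_succ_succ' b 1, ih]
    simp only [Nat.choose_one_right]
    ring

theorem choose_two_sum (l : Fin n → ℕ) :
    (∑ i, l i).choose 2 = ∑ i, (l i).choose 2 + ∑ i, ∑ j ∈ Finset.Ioi i, l i * l j := by
  induction n with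
  | zero => simp
  | succ n ih =>
    simp only [Fin.sum_univ_succ, Fin.sum_Ioi_zero, Fin.sum_Ioi_succ]
    rw [choose_two_add, ih, Finset.mul_sum]
    ring

theorem sum_Ioi_eq (l : Fin n → ℕ) :
    ∑ i, ∑ j ∈ Finset.Ioi i, l j = ∑ i : Fin n, (i : ℕ) * l i := by
  induction n with
  | zero => simp
  | succ n ih =>
    simp only [Fin.sum_univ_succ, Fin.sum_Ioi_zero, Fin.sum_Ioi_succ, ih, ← Finset.sum_add_distrib,
      Fin.val_zero, zero_mul, zero_add, Fin.val_succ]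
    exact Finset.sum_congr rfl fun i _ => by ring

/-- The origin of the weight `q^(iλ_i)`: in the asymmetric exponent `(l_i + 1) l_j` over `i < j`,
the term `l_j` is counted once for each smaller index. Indices start at `0`, hence `i + 1`. -/
theorem prod_pow_choose_eq (q : ℂ) (l : Fin n → ℕ) :
    (∏ i, q ^ (l i + 1).choose 2) * ∏ i, ∏ j ∈ Finset.Ioi i, q ^ ((l i + 1) * l j)
      = q ^ (∑ i, l i).choose 2 * ∏ i : Fin n, q ^ (((i : ℕ) + 1) * l i) := by
  simp only [Finset.prod_pow_eq_pow_sum, ← pow_add]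
  congr 1
  simp only [choose_two_sum, Nat.choose_succ_succ' _ 1, Nat.choose_one_right, add_mul, one_mul,
    Finset.sum_add_distrib, sum_Ioi_eq]
  ring

/-- The case `N = l` of the numerator in the series. Diagonal terms come from `ellFac_neg_self`; for
`i < j` the two terms and the Vandermonde quotient combine by `ellFac_pair`. -/
theorem prod_ellFac_neg {p q : ℂ} (hp : ‖p‖ < 1) (hq : q ≠ 0) {t : Fin n → ℂ} (ht : ∀ i, t i ≠ 0)
    (hθ : ∀ i j, i < j → ellTheta p (t i * (t j)⁻¹) ≠ 0) (l : Fin n → ℕ) :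
    (∏ i, ∏ j, ellFac p q (q ^ (-(l j : ℤ)) * t i * (t j)⁻¹) (l i)) *
      (∏ i, ∏ j ∈ Finset.Ioi i,
        ellTheta p (q ^ ((l i : ℤ) - (l j : ℤ)) * t i * (t j)⁻¹) / ellTheta p (t i * (t j)⁻¹)) *
      (∏ i : Fin n, q ^ (((i : ℕ) + 1) * l i))
    = (-1) ^ (∑ i, l i) * (q ^ (∑ i, l i).choose 2)⁻¹ *
      ∏ i, ∏ j, ellFac p q (q * t i * (t j)⁻¹) (l i) := by
  have hqc : q ^ (∑ i, l i).choose 2 ≠ 0 := pow_ne_zero _ hq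
  have key : (∏ i, ∏ j, ellFac p q (q ^ (-(l j : ℤ)) * t i * (t j)⁻¹) (l i)) *
      (∏ i, ∏ j ∈ Finset.Ioi i,
        ellTheta p (q ^ ((l i : ℤ) - (l j : ℤ)) * t i * (t j)⁻¹) / ellTheta p (t i * (t j)⁻¹)) *
      ((∏ i, q ^ (l i + 1).choose 2) * ∏ i, ∏ j ∈ Finset.Ioi i, q ^ ((l i + 1) * l j))
      = (-1) ^ (∑ i, l i) * ∏ i, ∏ j, ellFac p q (q * t i * (t j)⁻¹) (l i) := by
    rw [prod_prod_eq_diag_mul, prod_prod_eq_diag_mul (fun i j =>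
      ellFac p q (q * t i * (t j)⁻¹) (l i)), ← Finset.prod_pow_eq_pow_sum]
    rw [show ∀ a b c d e : ℂ, a * b * c * (d * e) = (a * d) * (b * c * e) from
      fun a b c d e => by ring, ← mul_assoc (∏ i, (-1 : ℂ) ^ l i)]
    congr 1
    · rw [← Finset.prod_mul_distrib, ← Finset.prod_mul_distrib]
      refine Finset.prod_congr rfl fun i _ => ?_
      rw [mul_assoc, mul_inv_cancel₀ (ht i), mul_one, mul_assoc q, mul_inv_cancel₀ (ht i), mul_one,
        ellFac_neg_self hp hq]
    · rw [← Finset.prod_mul_distrib, ← Finset.prod_mul_distrib]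
      refine Finset.prod_congr rfl fun i _ => ?_
      rw [← Finset.prod_mul_distrib, ← Finset.prod_mul_distrib]
      refine Finset.prod_congr rfl fun j hj => ?_
      have hx : t i * (t j)⁻¹ ≠ 0 := mul_ne_zero (ht i) (inv_ne_zero (ht j))
      have h := ellFac_pair hp hq hx (l i) (l j)
      have h0 := hθ i j (Finset.mem_Ioi.1 hj)
      rw [show (t i * (t j)⁻¹)⁻¹ = t j * (t i)⁻¹ by rw [mul_inv, inv_inv, mul_comm]] at h
      simp only [← mul_assoc] at h
      rw [mul_div_assoc', div_mul_eq_mul_div, h, mul_assoc, mul_div_cancel_left₀ _ h0]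
  rw [prod_pow_choose_eq] at key
  rw [mul_right_comm _ (q ^ (∑ i, l i).choose 2)⁻¹, ← key]
  field_simp

end Blocks

/-! ### The factors of the subset sum on blocks -/

section BlockProducts

variable {n : ℕ} {p q : ℂ} {t : Fin n → ℂ}

theorem prod_blockSet_ellTheta_mul (l : Fin n → ℕ) (b : ℂ) :
    ∏ a ∈ blockSet l, ellTheta p (blockVar q t a * b) = ∏ i, ellFac p q (t i * b) (l i) := by
  rw [prod_blockSet]
  refine Finset.prod_congr rfl fun i _ => Finset.prod_congr rfl fun k _ => ?_
  congr 1
  simp only [blockVar, ofLex_toLex]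
  ring

theorem prod_blockSet_ellTheta_div (hq : q ≠ 0) {l : Fin n → ℕ} {s : ℕ}
    (hl : ∀ i, l i ≤ s) {α γ : ℂ} (h : q * γ = q ^ s * α) :
    (∏ i, ellFac p q (α * (t i)⁻¹) (s - l i)) * ∏ a ∈ blockSet l, ellTheta p (γ / blockVar q t a)
      = ∏ i, ellFac p q (α * (t i)⁻¹) s := by
  rw [prod_blockSet, ← Finset.prod_mul_distrib]
  refine Finset.prod_congr rfl fun i _ => ?_
  rw [ellFac_eq_mul_prod_div (γ := γ / t i) hq (hl i)]
  · refine congrArg _ (Finset.prod_congr rfl fun k _ => ?_)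
    rw [div_div]
    rfl
  · rw [div_eq_mul_inv, ← mul_assoc, h]
    ring

theorem prod_blockSet_window {l N : Fin n → ℕ} (hl : l ≤ N) (T : ℂ) (s : ℕ) :
    (∏ i, ellFac p q (T * t i) s) * ((∏ a ∈ blockSet l, ellTheta p (T * blockVar q t a * q ^ s)) *
      ∏ a ∈ blockSet N \ blockSet l, ellTheta p (T * blockVar q t a * q ^ (s + 1))) *
      (∏ i, ellTheta p (T * t i * q ^ (l i + s)))
      = (∏ i, ellTheta p (T * t i)) * (∏ i, ellFac p q (q * T * t i) (N i)) *
        ∏ i, ellFac p q (q ^ (N i + 1) * T * t i) s := by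
  rw [prod_blockSet, prod_blockSet_sdiff]
  simp only [← Finset.prod_mul_distrib, blockVar, ofLex_toLex]
  refine Finset.prod_congr rfl fun i _ => ?_
  have := ellFac_shift_window (p := p) (q := q) (x := T * t i) s (l i) (N i) (hl i)
  simp only [← mul_assoc] at this ⊢
  exact this

/-- Two different blocks give a telescoping rectangle. One block gives a triangle, to which the
factors `θ(z_a²/B)⁻¹` supply the diagonal. -/
theorem pairFactor_blockSet {B : ℂ} (hy : ∀ i j, ∀ m : ℕ, ellTheta p (t i * t j / B * q ^ m) ≠ 0)
    (l : Fin n → ℕ) :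
    pairFactor p q B (blockVar q t) (blockSet l) *
        ∏ a ∈ blockSet l, (ellTheta p (blockVar q t a ^ 2 / B))⁻¹
      = (∏ i, ∏ j ∈ Finset.Ioi i, ellFac p q (t i * t j / B) (l i + l j)) *
        (∏ i, ∏ j, ellFac p q (t i * t j / B) (l i))⁻¹ := by
  set φ : Fin n → Fin n → ℕ → ℂ := fun i j m => ellTheta p (t i * t j / B * q ^ m) with hφ
  have hfac : ∀ i j m, ellFac p q (t i * t j / B) m = ∏ k ∈ Finset.range m, φ i j k :=
    fun i j m => rfl
  have hfac0 : ∀ i j m, ellFac p q (t i * t j / B) m ≠ 0 := fun i j m =>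
    Finset.prod_ne_zero_iff.2 fun k _ => hy i j k
  -- The condition is the lexicographic order on pairs, so `G` is trivial for `i > j`.
  set G : Fin n → Fin n → ℂ := fun i j => ∏ k ∈ Finset.range (l i), ∏ m ∈ Finset.range (l j),
    if i < j ∨ i = j ∧ k < m then φ i j (k + m + 1) / φ i j (k + m) else 1 with hG
  have e1 : pairFactor p q B (blockVar q t) (blockSet l) = ∏ i, ∏ j, G i j := by
    rw [pairFactor, prod_blockSet]
    refine Finset.prod_congr rfl fun i _ => ?_
    rw [hG]
    dsimp only
    rw [Finset.prod_comm]
    refine Finset.prod_congr rfl fun k _ => ?_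
    rw [Finset.prod_filter, prod_blockSet]
    refine Finset.prod_congr rfl fun j _ => Finset.prod_congr rfl fun m _ => ?_
    simp only [Prod.Lex.toLex_lt_toLex]
    refine if_congr Iff.rfl ?_ rfl
    simp only [hφ, blockVar, ofLex_toLex]
    congr 2 <;> ring
  have e2 : ∏ i, ∏ j, G i j = (∏ i, G i i) * ∏ i, ∏ j ∈ Finset.Ioi i, G i j := by
    rw [prod_prod_eq_diag_mul]
    refine congrArg _ (Finset.prod_congr rfl fun i _ => Finset.prod_congr rfl fun j hj => ?_)
    have hij := Finset.mem_Ioi.1 hj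
    have : G j i = 1 := Finset.prod_eq_one fun k _ => Finset.prod_eq_one fun m _ =>
      if_neg (by rintro (h | h); exacts [h.not_gt hij, hij.ne' h.1])
    rw [this, mul_one]
  have e3 : ∏ a ∈ blockSet l, (ellTheta p (blockVar q t a ^ 2 / B))⁻¹
      = ∏ i, ∏ k ∈ Finset.range (l i), (φ i i (k + k))⁻¹ := by
    rw [prod_blockSet]
    refine Finset.prod_congr rfl fun i _ => Finset.prod_congr rfl fun k _ => ?_
    simp only [hφ, blockVar, ofLex_toLex]
    congr 2
    ring
  have e4 : ∀ i, (∏ k ∈ Finset.range (l i), (φ i i (k + k))⁻¹) * G i i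
      = (ellFac p q (t i * t i / B) (l i))⁻¹ := fun i => by
    rw [hfac, ← prod_range_diag_div (hy i i)]
    simp [hG, hφ]
  have e5 : ∀ i j, i < j → G i j = ellFac p q (t i * t j / B) (l i + l j) /
      (ellFac p q (t i * t j / B) (l i) * ellFac p q (t i * t j / B) (l j)) := fun i j hij => by
    rw [hfac, hfac, hfac, ← prod_range_prod_range_div (hy i j)]
    simp [hG, hφ, hij]
  rw [e1, e2, e3, prod_prod_eq_diag_mul (fun i j => ellFac p q (t i * t j / B) (l i)),
    mul_comm, ← mul_assoc, ← Finset.prod_mul_distrib, Finset.prod_congr rfl fun i _ => e4 i,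
    mul_inv, mul_left_comm, Finset.prod_inv_distrib]
  congr 1
  simp only [← Finset.prod_inv_distrib]
  simp only [← Finset.prod_mul_distrib]
  refine Finset.prod_congr rfl fun i _ => Finset.prod_congr rfl fun j hj => ?_
  rw [e5 i j (Finset.mem_Ioi.1 hj), mul_comm (t j) (t i), div_eq_mul_inv]

/-- For fixed `a` in block `i`, the product over the complementary part of block `j` telescopes from
shift `l_j` to shift `N_j`. -/
theorem prod_cross_blockSet (hq : q ≠ 0) (ht : ∀ i, t i ≠ 0) {l N : Fin n → ℕ} (hl : l ≤ N)
    (hx : ∀ i j, ∀ m : ℤ, -(N j : ℤ) ≤ m → m < N i → (i ≠ j ∨ m ≠ 0) →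
      ellTheta p (q ^ m * t i * (t j)⁻¹) ≠ 0) :
    (∏ a ∈ blockSet l, ∏ c ∈ blockSet N \ blockSet l,
        ellTheta p (blockVar q t a / (q * blockVar q t c)) /
          ellTheta p (blockVar q t a / blockVar q t c)) *
      ∏ i, ∏ j, ellFac p q (q ^ (-(l j : ℤ)) * t i * (t j)⁻¹) (l i)
      = ∏ i, ∏ j, ellFac p q (q ^ (-(N j : ℤ)) * t i * (t j)⁻¹) (l i) := by
  have e1 : (∏ a ∈ blockSet l, ∏ c ∈ blockSet N \ blockSet l,
        ellTheta p (blockVar q t a / (q * blockVar q t c)) /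
          ellTheta p (blockVar q t a / blockVar q t c))
      = ∏ i, ∏ j, ∏ k ∈ Finset.range (l i), ∏ m ∈ Finset.Ico (l j) (N j),
        ellTheta p (q ^ ((k : ℤ) - m - 1) * t i * (t j)⁻¹) /
          ellTheta p (q ^ ((k : ℤ) - m) * t i * (t j)⁻¹) := by
    rw [prod_blockSet]
    refine Finset.prod_congr rfl fun i _ => ?_
    rw [Finset.prod_comm (s := Finset.univ)]
    refine Finset.prod_congr rfl fun k _ => ?_
    rw [prod_blockSet_sdiff]
    refine Finset.prod_congr rfl fun j _ => Finset.prod_congr rfl fun m _ => ?_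
    have htj := ht j
    have hqm := pow_ne_zero m hq
    simp only [blockVar, ofLex_toLex]
    congr 2
    · rw [zpow_sub₀ hq, zpow_sub₀ hq, zpow_natCast, zpow_natCast, zpow_one]
      field_simp
    · rw [zpow_sub₀ hq, zpow_natCast, zpow_natCast]
      field_simp
  rw [e1, ← Finset.prod_mul_distrib]
  refine Finset.prod_congr rfl fun i _ => ?_
  rw [← Finset.prod_mul_distrib]
  refine Finset.prod_congr rfl fun j _ => ?_
  have hk : ∀ k ∈ Finset.range (l i), ∀ m : ℕ, l j ≤ m → m ≤ N j →
      ellTheta p (q ^ ((k : ℤ) - m) * t i * (t j)⁻¹) ≠ 0 := fun k hk m h1 h2 => by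
    have hk := Finset.mem_range.1 hk
    have hi : l i ≤ N i := hl i
    refine hx i j _ (by omega) (by omega) ?_
    by_cases hij : i = j
    · subst hij; right; omega
    · exact Or.inl hij
  have hshift : ∀ M : ℕ, ellFac p q (q ^ (-(M : ℤ)) * t i * (t j)⁻¹) (l i)
      = ∏ k ∈ Finset.range (l i), ellTheta p (q ^ ((k : ℤ) - M) * t i * (t j)⁻¹) := fun M =>
    Finset.prod_congr rfl fun k _ => by
      rw [sub_eq_add_neg, zpow_add₀ hq, zpow_natCast]; congr 1; ring
  rw [hshift, hshift, ← Finset.prod_mul_distrib]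
  refine Finset.prod_congr rfl fun k hk' => ?_
  rw [prod_Ico_div_telescope (ψ := fun m => ellTheta p (q ^ m * t i * (t j)⁻¹)) (hl j) k
    (hk k hk'), div_mul_cancel₀]
  exact hk k hk' _ le_rfl (hl j)

end BlockProducts

/-! ### The multiple series for generic parameters -/

section Multiple

variable {n : ℕ}

/-- The summand of the multiple series. -/
noncomputable def multTerm (p q T A : ℂ) (t : Fin n → ℂ) (b : Fin 3 → ℂ) (N : Fin n → ℕ) (K : ℕ)
    (l : Fin n → ℕ) : ℂ :=
  (∏ i, ellTheta p (T * t i * q ^ (l i + ∑ k, l k)) / ellTheta p (T * t i)) *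
      (∏ i, ∏ j ∈ Finset.Ioi i,
        ellTheta p (q ^ ((l i : ℤ) - (l j : ℤ)) * t i * (t j)⁻¹) / ellTheta p (t i * (t j)⁻¹) *
          ellFac p q (q ^ (1 - (K : ℤ)) * A⁻¹ * t i * t j) (l i + l j)) *
      (∏ i, ∏ j, ellFac p q (q ^ (-(N j : ℤ)) * t i * (t j)⁻¹) (l i) /
        (ellFac p q (q * t i * (t j)⁻¹) (l i) *
          ellFac p q (q ^ (1 - (K : ℤ)) * A⁻¹ * t i * t j) (l i))) *
      (∏ j, (∏ i, ellFac p q (t i * b j) (l i)) / ellFac p q (q * T * (b j)⁻¹) (∑ k, l k)) *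
      (∏ i, ellFac p q (T * t i) (∑ k, l k) *
          ellFac p q (q ^ K * A * T * (t i)⁻¹) (∑ k, l k) * q ^ (((i : ℕ) + 1) * l i) /
        (ellFac p q (q ^ (N i + 1) * T * t i) (∑ k, l k) *
          ellFac p q (q ^ K * A * T * (t i)⁻¹) ((∑ k, l k) - l i)))

/-- The value of the multiple series. -/
noncomputable def multValue (p q T A : ℂ) (t : Fin n → ℂ) (b : Fin 3 → ℂ) (N : Fin n → ℕ)
    (K : ℕ) : ℂ :=
  (∏ i, ∏ j, ellFac p q (A * (t i)⁻¹ * (t j)⁻¹) (K - N i) /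
          ellFac p q (A * (t i)⁻¹ * (t j)⁻¹) K) *
      (∏ i, ∏ j ∈ Finset.Ioi i, ellFac p q (A * (t i)⁻¹ * (t j)⁻¹) K /
          ellFac p q (A * (t i)⁻¹ * (t j)⁻¹) (K - N i - N j)) *
      (∏ i, ∏ j, ellFac p q (A * (t i)⁻¹ * b j) K /
          ellFac p q (A * (t i)⁻¹ * b j) (K - N i)) *
      (∏ i, ellFac p q (q * T * t i) (N i)) *
      (∏ j, 1 / ellFac p q (q * T * (b j)⁻¹) K)

variable {p q T A B : ℂ} {t : Fin n → ℂ} {b : Fin 3 → ℂ} {N : Fin n → ℕ} {K : ℕ}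

theorem paramFactor_blockSet (hK : K = ∑ i, N i) {l : Fin n → ℕ} (hl : l ≤ N) (c : ℂ) :
    paramFactor p q T (blockVar q t) (blockSet N) (blockSet l) c *
        ellFac p q (q * T * c⁻¹) (∑ i, l i)
      = (∏ i, ellFac p q (t i * c) (l i)) * ellFac p q (q * T * c⁻¹) K := by
  have hs : ∑ i, l i ≤ K := hK ▸ Finset.sum_le_sum fun i _ => hl i
  rw [paramFactor, prod_blockSet_ellTheta_mul, card_blockSet, card_blockSet, ← hK, mul_assoc]
  congr 1
  rw [ellFac, ellFac, ← Finset.prod_range_mul_prod_Ico _ hs, mul_comm]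
  congr 1
  refine Finset.prod_congr rfl fun k _ => ?_
  congr 1
  rw [div_eq_mul_inv]
  ring

/-- Field algebra with each whole product treated as one unknown. The auxiliary `XL`, common to the
cross terms and the Vandermonde terms, is eliminated without dividing by it. -/
theorem combine_block_factors {sg PX PY PZ PW pr cr F₀ F₁ F₂ QN Θ Θ₀ V Y₂ XN XQ Y₁ B₀ B₁ B₂ C₀ C₁
    C₂ Ts A₂ Qi Qs A₁ D₀ D₁ D₂ XL : ℂ} (f₀ : F₀ * C₀ = B₀ * D₀) (f₁ : F₁ * C₁ = B₁ * D₁)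
    (f₂ : F₂ * C₂ = B₂ * D₂) (f₃ : A₁ * PX = A₂) (f₄ : Ts * (PZ * PW) * Θ = Θ₀ * QN * Qs)
    (f₅ : pr * PY⁻¹ = Y₂ * Y₁⁻¹) (f₆ : cr * XL = XN) (f₇ : XL * V * Qi = sg * XQ)
    (c₀ : C₀ ≠ 0) (c₁ : C₁ ≠ 0) (c₂ : C₂ ≠ 0) (n₃ : A₁ ≠ 0) (n₄ : Θ₀ * QN * Qs ≠ 0)
    (n₇ : XQ ≠ 0) :
    sg * (PX / (PY * PZ)) * PW⁻¹ * pr * cr * (F₀ * F₁ * F₂) * QN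
      = Θ / Θ₀ * (V * Y₂) * (XN / (XQ * Y₁)) * (B₀ * B₁ * B₂ / (C₀ * C₁ * C₂)) *
        (Ts * A₂ * Qi / (Qs * A₁)) * (D₀ * D₁ * D₂) := by
  have hQs := right_ne_zero_of_mul n₄
  have hΘ₀ := left_ne_zero_of_mul (left_ne_zero_of_mul n₄)
  have n₄' := n₄
  rw [← f₄] at n₄'
  have hPZ := left_ne_zero_of_mul (right_ne_zero_of_mul (left_ne_zero_of_mul n₄'))
  have hPW := right_ne_zero_of_mul (right_ne_zero_of_mul (left_ne_zero_of_mul n₄'))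
  have g₁ : sg * cr = V * Qi * XN * XQ⁻¹ := by
    rw [eq_mul_inv_iff_mul_eq₀ n₇, ← f₆]
    linear_combination -cr * f₇
  have g₂ : PX = A₂ * A₁⁻¹ := by rw [eq_mul_inv_iff_mul_eq₀ n₃, mul_comm, f₃]
  have g₃ : QN * (PZ * PW)⁻¹ = Ts * Θ * (Θ₀ * Qs)⁻¹ := by
    rw [eq_mul_inv_iff_mul_eq₀ (mul_ne_zero hΘ₀ hQs), mul_right_comm,
      mul_inv_eq_iff_eq_mul₀ (mul_ne_zero hPZ hPW)]
    linear_combination -f₄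
  have e₀ : F₀ = B₀ * D₀ * C₀⁻¹ := by rw [← f₀, mul_inv_cancel_right₀ c₀]
  have e₁ : F₁ = B₁ * D₁ * C₁⁻¹ := by rw [← f₁, mul_inv_cancel_right₀ c₁]
  have e₂ : F₂ = B₂ * D₂ * C₂⁻¹ := by rw [← f₂, mul_inv_cancel_right₀ c₂]
  calc sg * (PX / (PY * PZ)) * PW⁻¹ * pr * cr * (F₀ * F₁ * F₂) * QN
      = sg * cr * PX * (pr * PY⁻¹) * (QN * (PZ * PW)⁻¹) * (F₀ * F₁ * F₂) := by
        simp only [div_eq_mul_inv, mul_inv]; ring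
    _ = V * Qi * XN * XQ⁻¹ * (A₂ * A₁⁻¹) * (Y₂ * Y₁⁻¹) * (Ts * Θ * (Θ₀ * Qs)⁻¹) *
        (B₀ * D₀ * C₀⁻¹ * (B₁ * D₁ * C₁⁻¹) * (B₂ * D₂ * C₂⁻¹)) := by
        rw [g₁, g₂, f₅, g₃, e₀, e₁, e₂]
    _ = _ := by simp only [div_eq_mul_inv, mul_inv]; ring

theorem combine_monomials {c Z M R Y₁ Y₂ : ℂ} (h : Z * M = c * R) (hM : M ≠ 0) (hY : Y₁ ≠ 0)
    (hc : c ≠ 0) : c⁻¹ * Z * (Y₂ * Y₁⁻¹) = R / Y₁ * (Y₂ / M) := by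
  field_simp
  linear_combination Y₂ * h

/-- The terms agree up to factors independent of `l`. The choice `B = q^(K-1) A` is dictated by the
arguments `t_i t_j/B = q^(1-K) A⁻¹ t_i t_j`. -/
theorem subsetWeight_blockSet (hp : ‖p‖ < 1) (hq : q ≠ 0) (ht : ∀ i, t i ≠ 0)
    (hA : A ≠ 0) (hK : K = ∑ i, N i) (hB : B = q ^ ((K : ℤ) - 1) * A)
    (hx : ∀ i j, ∀ m : ℤ, -(N j : ℤ) ≤ m → m ≤ N i → (i ≠ j ∨ m ≠ 0) →
      ellTheta p (q ^ m * t i * (t j)⁻¹) ≠ 0)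
    (hy : ∀ i j, ∀ m : ℕ, ellTheta p (t i * t j / B * q ^ m) ≠ 0)
    (hT : ∀ i, ∀ m : ℕ, ellTheta p (T * t i * q ^ m) ≠ 0)
    (hTb : ∀ j, ellFac p q (q * T * (b j)⁻¹) K ≠ 0)
    (hAT : ∀ i, ellFac p q (q ^ K * A * T * (t i)⁻¹) (K - N i) ≠ 0)
    {l : Fin n → ℕ} (hl : l ≤ N) :
    subsetWeight p q T B (blockVar q t) (blockSet N) (blockSet l) *
        (paramFactor p q T (blockVar q t) (blockSet N) (blockSet l) (b 0) *
          paramFactor p q T (blockVar q t) (blockSet N) (blockSet l) (b 1) *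
          paramFactor p q T (blockVar q t) (blockSet N) (blockSet l) (b 2)) *
        ∏ i, ellFac p q (q * T * t i) (N i)
      = multTerm p q T A t b N K l * ∏ j, ellFac p q (q * T * (b j)⁻¹) K := by
  have hqB : q * B = q ^ K * A := by
    rw [hB, ← mul_assoc, ← zpow_one_add₀ hq, add_sub_cancel, zpow_natCast]
  have hB0 : B ≠ 0 := fun h => mul_ne_zero (pow_ne_zero K hq) hA (by rw [← hqB, h, mul_zero])
  have hyB : ∀ i j, q ^ (1 - (K : ℤ)) * A⁻¹ * t i * t j = t i * t j / B := fun i j => by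
    rw [hB, div_eq_mul_inv, mul_inv, ← zpow_neg, neg_sub]; ring
  have hs : ∑ i, l i ≤ K := hK ▸ Finset.sum_le_sum fun i _ => hl i
  have hls : ∀ i, l i ≤ ∑ k, l k := fun i =>
    Finset.single_le_sum (fun _ _ => Nat.zero_le _) (Finset.mem_univ i)
  -- Both sides are sums over the indices other than `i`; so non-vanishing at length `K - N i`
  -- covers all the denominators that occur.
  have hsub : ∀ i, ∑ k, l k - l i ≤ K - N i := fun i => by
    rw [hK, ← Finset.add_sum_erase _ l (Finset.mem_univ i),
      ← Finset.add_sum_erase _ N (Finset.mem_univ i), Nat.add_sub_cancel_left,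
      Nat.add_sub_cancel_left]
    exact Finset.sum_le_sum fun j _ => hl j
  have f0 := paramFactor_blockSet (p := p) (q := q) (T := T) (t := t) hK hl (b 0)
  have f1 := paramFactor_blockSet (p := p) (q := q) (T := T) (t := t) hK hl (b 1)
  have f2 := paramFactor_blockSet (p := p) (q := q) (T := T) (t := t) hK hl (b 2)
  have f3 := prod_blockSet_ellTheta_div (p := p) (t := t) hq hls
    (α := q ^ K * A * T) (γ := q ^ (∑ k, l k) * B * T) (by
      linear_combination (q ^ (∑ k, l k) * T) * hqB)
  have f4 := prod_blockSet_window (p := p) (q := q) (t := t) hl T (∑ k, l k)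
  have f5 := pairFactor_blockSet hy l
  have f6 := prod_cross_blockSet hq ht hl fun i j m h1 h2 h3 => hx i j m h1 h2.le h3
  have hθ : ∀ i j, i < j → ellTheta p (t i * (t j)⁻¹) ≠ 0 := fun i j h => by
    have := hx i j 0 (by omega) (by omega) (Or.inl h.ne)
    rwa [zpow_zero, one_mul] at this
  have f7 := prod_ellFac_neg hp hq ht hθ l
  have n0 : ∀ j, ellFac p q (q * T * (b j)⁻¹) (∑ k, l k) ≠ 0 := fun j =>
    ellFac_ne_zero_of_le (hTb j) hs
  have n3 : ∏ i, ellFac p q (q ^ K * A * T * (t i)⁻¹) (∑ k, l k - l i) ≠ 0 :=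
    Finset.prod_ne_zero_iff.2 fun i _ => ellFac_ne_zero_of_le (hAT i) (hsub i)
  have n4 : (∏ i, ellTheta p (T * t i)) * (∏ i, ellFac p q (q * T * t i) (N i)) *
      ∏ i, ellFac p q (q ^ (N i + 1) * T * t i) (∑ k, l k) ≠ 0 := by
    refine mul_ne_zero (mul_ne_zero ?_ ?_) ?_ <;> refine Finset.prod_ne_zero_iff.2 fun i _ => ?_
    · simpa using hT i 0
    · refine Finset.prod_ne_zero_iff.2 fun k _ => ?_
      convert hT i (k + 1) using 2; ring
    · refine Finset.prod_ne_zero_iff.2 fun k _ => ?_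
      convert hT i (N i + 1 + k) using 2; ring
  have n7 : ∏ i, ∏ j, ellFac p q (q * t i * (t j)⁻¹) (l i) ≠ 0 := by
    refine Finset.prod_ne_zero_iff.2 fun i _ => Finset.prod_ne_zero_iff.2 fun j _ =>
      Finset.prod_ne_zero_iff.2 fun k hk => ?_
    have hk := Finset.mem_range.1 hk
    have hi : l i ≤ N i := hl i
    convert hx i j ((k : ℤ) + 1) (by omega) (by omega) (Or.inr (by omega)) using 2
    rw [zpow_add_one₀ hq, zpow_natCast]; ring
  rw [subsetWeight, multTerm]
  simp only [hyB, card_blockSet, Finset.prod_mul_distrib, Finset.prod_div_distrib,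
    Finset.prod_inv_distrib, Fin.prod_univ_three] at f5 f6 f7 ⊢
  have m0 := n0 0
  have m1 := n0 1
  have m2 := n0 2
  exact combine_block_factors f0 f1 f2 f3 f4 f5 f6 f7 m0 m1 m2 n3 n4 n7

/-- Reflection converts factorials in `t_i t_j/B` to those in `A/(t_i t_j)`. The monomials it
creates cancel against the product of `-z_a²/B` and the power of `q`, by `choose_two_sum`. -/
theorem prod_ellFac_reflect (hp : ‖p‖ < 1) (hq : q ≠ 0) (ht : ∀ i, t i ≠ 0) (hB0 : B ≠ 0)
    (hK : K = ∑ i, N i) (hqB : q * B = q ^ K * A)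
    (hy : ∀ i j, ∀ m : ℕ, ellTheta p (t i * t j / B * q ^ m) ≠ 0)
    (hD : ∀ i j, ellFac p q (A * (t i)⁻¹ * (t j)⁻¹) K ≠ 0) :
    (q ^ K.choose 2)⁻¹ * (∏ a ∈ blockSet N, -(blockVar q t a ^ 2 / B)) *
        ((∏ i, ∏ j ∈ Finset.Ioi i, ellFac p q (t i * t j / B) (N i + N j)) *
          (∏ i, ∏ j, ellFac p q (t i * t j / B) (N i))⁻¹)
      = (∏ i, ∏ j, ellFac p q (A * (t i)⁻¹ * (t j)⁻¹) (K - N i) /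
          ellFac p q (A * (t i)⁻¹ * (t j)⁻¹) K) *
      (∏ i, ∏ j ∈ Finset.Ioi i, ellFac p q (A * (t i)⁻¹ * (t j)⁻¹) K /
          ellFac p q (A * (t i)⁻¹ * (t j)⁻¹) (K - N i - N j)) := by
  have hy0 : ∀ i j, t i * t j / B ≠ 0 := fun i j =>
    div_ne_zero (mul_ne_zero (ht i) (ht j)) hB0
  have hfac0 : ∀ i j m, ellFac p q (t i * t j / B) m ≠ 0 := fun i j m =>
    Finset.prod_ne_zero_iff.2 fun k _ => hy i j k
  have hrefl : ∀ i j m, m ≤ K → ellFac p q (t i * t j / B) m *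
      ellFac p q (A * (t i)⁻¹ * (t j)⁻¹) (K - m) = (-(t i * t j / B)) ^ m * q ^ m.choose 2 *
        ellFac p q (A * (t i)⁻¹ * (t j)⁻¹) K := fun i j m hm => by
    refine ellFac_reflect hp hq (hy0 i j) hm rfl ?_
    rw [inv_div, div_eq_mul_inv, ← mul_assoc, hqB, mul_inv]
    ring
  have hNi : ∀ i, N i ≤ K := fun i => hK ▸
    Finset.single_le_sum (fun _ _ => Nat.zero_le _) (Finset.mem_univ i)
  have hNij : ∀ i j, i < j → N i + N j ≤ K := fun i j hij => by
    rw [hK, ← Finset.sum_pair (f := N) hij.ne]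
    exact Finset.sum_le_sum_of_subset (Finset.subset_univ _)
  have hmon0 : ∀ i j m, (-(t i * t j / B)) ^ m * q ^ m.choose 2 ≠ 0 := fun i j m =>
    mul_ne_zero (pow_ne_zero _ (neg_ne_zero.2 (hy0 i j))) (pow_ne_zero _ hq)
  have e1 : ∀ i j, ellFac p q (A * (t i)⁻¹ * (t j)⁻¹) (K - N i) /
      ellFac p q (A * (t i)⁻¹ * (t j)⁻¹) K
      = ((-(t i * t j / B)) ^ N i * q ^ (N i).choose 2) / ellFac p q (t i * t j / B) (N i) :=
    fun i j => by
      rw [div_eq_div_iff (hD i j) (hfac0 i j _), mul_comm, hrefl i j _ (hNi i)]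
  have e2 : ∀ i j, i < j → ellFac p q (A * (t i)⁻¹ * (t j)⁻¹) K /
      ellFac p q (A * (t i)⁻¹ * (t j)⁻¹) (K - N i - N j)
      = ellFac p q (t i * t j / B) (N i + N j) /
        ((-(t i * t j / B)) ^ (N i + N j) * q ^ (N i + N j).choose 2) := fun i j hij => by
    rw [Nat.sub_sub, div_eq_div_iff (ellFac_ne_zero_of_le (hD i j) (Nat.sub_le _ _))
      (hmon0 i j _), hrefl i j _ (hNij i j hij), mul_comm]
  have e3 : ∏ i, ∏ j ∈ Finset.Ioi i, ellFac p q (A * (t i)⁻¹ * (t j)⁻¹) K /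
      ellFac p q (A * (t i)⁻¹ * (t j)⁻¹) (K - N i - N j)
      = ∏ i, ∏ j ∈ Finset.Ioi i, ellFac p q (t i * t j / B) (N i + N j) /
        ((-(t i * t j / B)) ^ (N i + N j) * q ^ (N i + N j).choose 2) :=
    Finset.prod_congr rfl fun i _ => Finset.prod_congr rfl fun j hj =>
      e2 i j (Finset.mem_Ioi.1 hj)
  have e4 : (∏ a ∈ blockSet N, -(blockVar q t a ^ 2 / B)) *
      (∏ i, ∏ j ∈ Finset.Ioi i, (-(t i * t j / B)) ^ (N i + N j) * q ^ (N i + N j).choose 2)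
      = q ^ K.choose 2 * ∏ i, ∏ j, (-(t i * t j / B)) ^ N i * q ^ (N i).choose 2 := by
    have g1 : ∏ a ∈ blockSet N, -(blockVar q t a ^ 2 / B)
        = (∏ i, q ^ (N i).choose 2) * ∏ i, (-(t i * t i / B)) ^ N i * q ^ (N i).choose 2 := by
      rw [prod_blockSet, ← Finset.prod_mul_distrib]
      refine Finset.prod_congr rfl fun i _ => ?_
      induction N i with
      | zero => simp
      | succ m ih =>
        rw [Finset.prod_range_succ, ih, Nat.choose_succ_succ' m 1, Nat.choose_one_right]
        simp only [blockVar, ofLex_toLex]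
        ring
    have g2 : q ^ K.choose 2 = (∏ i, q ^ (N i).choose 2) *
        ∏ i, ∏ j ∈ Finset.Ioi i, q ^ (N i * N j) := by
      simp only [hK, choose_two_sum, pow_add, Finset.prod_pow_eq_pow_sum]
    rw [prod_prod_eq_diag_mul, g1, g2]
    rw [mul_mul_mul_comm]
    congr 1
    rw [← Finset.prod_mul_distrib]
    refine Finset.prod_congr rfl fun i _ => ?_
    rw [← Finset.prod_mul_distrib]
    refine Finset.prod_congr rfl fun j _ => ?_
    rw [choose_two_add, mul_comm (t j) (t i)]
    ring
  rw [e3]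
  simp only [e1]
  simp only [Finset.prod_div_distrib]
  have h1 : ∏ i, ∏ j ∈ Finset.Ioi i, (-(t i * t j / B)) ^ (N i + N j) *
      q ^ (N i + N j).choose 2 ≠ 0 :=
    Finset.prod_ne_zero_iff.2 fun i _ => Finset.prod_ne_zero_iff.2 fun j _ => hmon0 i j _
  have h2 : ∏ i, ∏ j, ellFac p q (t i * t j / B) (N i) ≠ 0 :=
    Finset.prod_ne_zero_iff.2 fun i _ => Finset.prod_ne_zero_iff.2 fun j _ => hfac0 i j _
  have h3 : q ^ K.choose 2 ≠ 0 := pow_ne_zero _ hq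
  exact combine_monomials e4 h1 h2 h3

theorem subsetValue_blockSet (hp : ‖p‖ < 1) (hq : q ≠ 0) (ht : ∀ i, t i ≠ 0)
    (hA : A ≠ 0) (hK : K = ∑ i, N i) (hB : B = q ^ ((K : ℤ) - 1) * A)
    (hy : ∀ i j, ∀ m : ℕ, ellTheta p (t i * t j / B * q ^ m) ≠ 0)
    (hTb : ∀ j, ellFac p q (q * T * (b j)⁻¹) K ≠ 0)
    (hD : ∀ i j, ellFac p q (A * (t i)⁻¹ * (t j)⁻¹) K ≠ 0)
    (hE : ∀ i j, ellFac p q (A * (t i)⁻¹ * b j) (K - N i) ≠ 0) :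
    subsetValue p q B (blockVar q t) (blockSet N) (b 0) (b 1) (b 2) *
        ∏ i, ellFac p q (q * T * t i) (N i)
      = multValue p q T A t b N K * ∏ j, ellFac p q (q * T * (b j)⁻¹) K := by
  have hqB : q * B = q ^ K * A := by
    rw [hB, ← mul_assoc, ← zpow_one_add₀ hq, add_sub_cancel, zpow_natCast]
  have hB0 : B ≠ 0 := fun h => mul_ne_zero (pow_ne_zero K hq) hA (by rw [← hqB, h, mul_zero])
  have hNi : ∀ i, N i ≤ K := fun i => hK ▸
    Finset.single_le_sum (fun _ _ => Nat.zero_le _) (Finset.mem_univ i)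
  have f : ∀ j, ∏ a ∈ blockSet N, ellTheta p (B * b j / blockVar q t a)
      = ∏ i, ellFac p q (A * (t i)⁻¹ * b j) K / ellFac p q (A * (t i)⁻¹ * b j) (K - N i) :=
    fun j => by
      have h := prod_blockSet_ellTheta_div (p := p) (t := t) hq hNi (α := A * b j)
        (γ := B * b j) (by linear_combination b j * hqB)
      simp only [mul_right_comm A (b j)] at h
      rw [Finset.prod_div_distrib, ← h, mul_div_cancel_left₀]
      exact Finset.prod_ne_zero_iff.2 fun i _ => hE i j
  have hC : ∏ j, ellFac p q (q * T * (b j)⁻¹) K ≠ 0 := Finset.prod_ne_zero_iff.2 fun j _ => hTb j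
  have h5 := pairFactor_blockSet hy N
  rw [multValue, ← prod_ellFac_reflect hp hq ht hB0 hK hqB hy hD, ← h5, subsetValue, card_blockSet,
    ← hK, Finset.prod_comm (f := fun i j => ellFac p q (A * (t i)⁻¹ * b j) K /
      ellFac p q (A * (t i)⁻¹ * b j) (K - N i)), Fin.prod_univ_three, ← f, ← f, ← f]
  simp only [one_div, Finset.prod_inv_distrib]
  rw [mul_assoc (_ * _) (_⁻¹), inv_mul_cancel₀ hC, mul_one]
  simp only [div_eq_mul_inv, Finset.prod_mul_distrib, Finset.prod_inv_distrib]
  ring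

/-- The multiple summation formula for generic parameters, with `T` independent of `t`. -/
theorem sum_multTerm_of_generic (hp : ‖p‖ < 1) (hq : q ≠ 0) (ht : ∀ i, t i ≠ 0)
    (hT0 : T ≠ 0) (hb : ∀ j, b j ≠ 0)
    (hA : A = q * T * (b 0)⁻¹ * (b 1)⁻¹ * (b 2)⁻¹) (hK : K = ∑ i, N i)
    (hB : B = q ^ ((K : ℤ) - 1) * A)
    (hx : ∀ i j, ∀ m : ℤ, -(N j : ℤ) ≤ m → m ≤ N i → (i ≠ j ∨ m ≠ 0) →
      ellTheta p (q ^ m * t i * (t j)⁻¹) ≠ 0)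
    (hy : ∀ i j, ∀ m : ℕ, ellTheta p (t i * t j / B * q ^ m) ≠ 0)
    (hT : ∀ i, ∀ m : ℕ, ellTheta p (T * t i * q ^ m) ≠ 0)
    (hβ : ∀ i j, ∀ m : ℕ, ellTheta p (T * t i * t j / (B * b 2) * q ^ m) ≠ 0)
    (hβT : ∀ i, ∀ m : ℕ, ellTheta p (t i / (B * b 2) * q ^ m) ≠ 0)
    (hTb : ∀ j, ellFac p q (q * T * (b j)⁻¹) K ≠ 0)
    (hAT : ∀ i, ellFac p q (q ^ K * A * T * (t i)⁻¹) (K - N i) ≠ 0)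
    (hD : ∀ i j, ellFac p q (A * (t i)⁻¹ * (t j)⁻¹) K ≠ 0)
    (hE : ∀ i j, ellFac p q (A * (t i)⁻¹ * b j) (K - N i) ≠ 0) :
    ∑ l ∈ Finset.Icc (0 : Fin n → ℕ) N, multTerm p q T A t b N K l
      = multValue p q T A t b N K := by
  have hA0 : A ≠ 0 := by
    rw [hA]
    have := fun j => inv_ne_zero (hb j)
    exact mul_ne_zero (mul_ne_zero (mul_ne_zero (mul_ne_zero hq hT0) (this 0)) (this 1)) (this 2)
  have hqB : q * B = q ^ K * A := by
    rw [hB, ← mul_assoc, ← zpow_one_add₀ hq, add_sub_cancel, zpow_natCast]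
  have hz : ∀ x, blockVar q t x ≠ 0 := fun x => mul_ne_zero (ht _) (pow_ne_zero _ hq)
  have hmain := sum_subsetWeight (p := p) (q := q) (T := T) (B := B) (b₃ := b 2) hp hq hT0 hz
    (blockSet N) ?_ ?_ ?_ ?_ ?_ (b 0) (b 1) ?_
  · rw [sum_powerset_blockSet] at hmain
    · have hC : ∏ j, ellFac p q (q * T * (b j)⁻¹) K ≠ 0 :=
        Finset.prod_ne_zero_iff.2 fun j _ => hTb j
      refine mul_right_cancel₀ hC ?_
      rw [← subsetValue_blockSet hp hq ht hA0 hK hB hy hTb hD hE, ← hmain, Finset.sum_mul,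
        Finset.sum_mul]
      exact Finset.sum_congr rfl fun l hl => (subsetWeight_blockSet hp hq ht hA0 hK hB hx hy hT hTb
        hAT (Finset.mem_Icc.1 hl).2).symm
    · intro S hS i k h1 h2
      have hk : toLex (i, k) ∈ blockSet N \ S := Finset.mem_sdiff.2 ⟨mem_blockSet.2
        ((Nat.lt_succ_self k).trans (mem_blockSet.1 (hS h1))), h2⟩
      have : blockVar q t (toLex (i, k + 1)) = q * blockVar q t (toLex (i, k)) := by
        simp only [blockVar, ofLex_toLex]; ring
      -- Adjacent variables in a block have ratio `q`, so a gap in `S` produces the numerator `θ(1)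
      -- = 0`.
      have h0 : ∏ a ∈ S, ∏ c ∈ blockSet N \ S, ellTheta p (blockVar q t a / (q * blockVar q t c)) /
          ellTheta p (blockVar q t a / blockVar q t c) = 0 :=
        Finset.prod_eq_zero h1 (Finset.prod_eq_zero hk (by
          rw [this, div_self (mul_ne_zero hq (hz _)), ellTheta_one hp, zero_div]))
      rw [subsetWeight, h0, mul_zero, zero_mul]
  · intro x hx' y hy' hxy
    have h1 := mem_blockSet.1 hx'
    have h2 := mem_blockSet.1 hy'
    convert hx (ofLex x).1 (ofLex y).1 ((ofLex x).2 - (ofLex y).2 : ℤ) (by omega) (by omega) ?_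
      using 2
    · have := ht (ofLex y).1
      have := pow_ne_zero (ofLex y).2 hq
      rw [blockVar, blockVar, zpow_sub₀ hq, zpow_natCast, zpow_natCast]
      field_simp
    · by_contra! h
      exact hxy (ofLex.injective (Prod.ext h.1 (by omega)))
  · intro x _ y _
    convert hy (ofLex x).1 (ofLex y).1 ((ofLex x).2 + (ofLex y).2) using 2
    simp only [blockVar]
    ring
  · intro x _ m
    convert hT (ofLex x).1 ((ofLex x).2 + m) using 2
    simp only [blockVar]
    ring
  · intro x _ y _ m
    convert hβ (ofLex x).1 (ofLex y).1 ((ofLex x).2 + (ofLex y).2 + m) using 2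
    simp only [blockVar]
    ring
  · intro x _
    convert hβT (ofLex x).1 (ofLex x).2 using 2
    simp only [blockVar]
    ring
  · rw [card_blockSet, ← hK]
    refine mul_left_cancel₀ hq ?_
    have h0 := hb 0
    have h1 := hb 1
    have h2 := hb 2
    rw [show q * (b 0 * b 1 * b 2 * B) = b 0 * b 1 * b 2 * (q * B) by ring, hqB, hA]
    field_simp

end Multiple

/-! ### Generic points and continuity -/

section Limit

variable {n : ℕ} {p q : ℂ}

/-- Allows genericity conditions for all `m : ℕ` to be imposed simultaneously. -/
instance countableInterFilter_cocountable : CountableInterFilter (cocountable : Filter ℂ) :=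
  cardinalInterFilter_aleph_one_iff.1 instCardinalInterFilter_cocardinal

theorem eventually_cocountable_ellTheta_ne_zero (hp : ‖p‖ < 1) {κ : ℂ} (hκ : κ ≠ 0) {e : ℤ}
    (he : e ≠ 0) : ∀ᶠ u in cocountable, ellTheta p (κ * u ^ e) ≠ 0 := by
  have h := (countable_ellTheta_zeros hp hκ he).union (Set.countable_singleton 0)
  refine mem_cocountable.2 (h.mono fun u hu => ?_)
  by_cases h0 : u = 0
  · exact Or.inr h0
  · exact Or.inl ⟨h0, not_not.1 hu⟩

theorem eventually_cocountable_ellFac_ne_zero (hp : ‖p‖ < 1) (hq : q ≠ 0) {κ : ℂ} (hκ : κ ≠ 0)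
    {e : ℤ} (he : e ≠ 0) (m : ℕ) : ∀ᶠ u in cocountable, ellFac p q (κ * u ^ e) m ≠ 0 := by
  have h : ∀ k : ℕ, ∀ᶠ u in cocountable, ellTheta p (κ * q ^ k * u ^ e) ≠ 0 := fun k =>
    eventually_cocountable_ellTheta_ne_zero hp (mul_ne_zero hκ (pow_ne_zero k hq)) he
  filter_upwards [eventually_countable_forall.2 h] with u hu
  refine Finset.prod_ne_zero_iff.2 fun k _ => ?_
  rw [mul_right_comm]
  exact hu k

/-- Complements of countable sets are dense in `ℂ`; this gives uniqueness of limits along generic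
points. -/
instance neBot_nhds_inf_cocountable (x : ℂ) : (𝓝 x ⊓ cocountable).NeBot := by
  rw [inf_neBot_iff]
  intro s hs s' hs'
  have hd : Dense s' := by
    have := Set.Countable.dense_compl ℂ (mem_cocountable.1 hs')
    rwa [compl_compl] at this
  obtain ⟨y, hy, hy'⟩ := (mem_closure_iff_nhds.1 (hd x)) s hs
  exact ⟨y, hy, hy'⟩

variable {t : Fin n → ℂ} {N : Fin n → ℕ} {K : ℕ}

/-- The conditions on the ratios `t_i/t_j` already follow from the given denominators: `m > 0`
directly, `m < 0` by inversion with `i`, `j` exchanged, and `m = 0` from the Vandermonde factors.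
This is why the `t_i` need no perturbation. -/
theorem ellTheta_zpow_mul_div_ne_zero (hp : ‖p‖ < 1) (hq : q ≠ 0) (ht : ∀ i, t i ≠ 0)
    (h2 : ∀ i j, i < j → ellTheta p (t i * (t j)⁻¹) ≠ 0)
    (h3 : ∀ i j, ellFac p q (q * t i * (t j)⁻¹) (N i) ≠ 0) (i j : Fin n) (m : ℤ)
    (hm : -(N j : ℤ) ≤ m) (hm' : m ≤ N i) (h : i ≠ j ∨ m ≠ 0) :
    ellTheta p (q ^ m * t i * (t j)⁻¹) ≠ 0 := by
  have hflip : ellTheta p (q ^ (-m) * t j * (t i)⁻¹) ≠ 0 →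
      ellTheta p (q ^ m * t i * (t j)⁻¹) ≠ 0 := fun h => by
    convert ellTheta_inv_ne_zero hp (mul_ne_zero (mul_ne_zero (zpow_ne_zero _ hq) (ht j))
      (inv_ne_zero (ht i))) h using 2
    rw [mul_inv, mul_inv, inv_inv, zpow_neg, inv_inv]
    ring
  have hpos : ∀ i j, ∀ m : ℤ, 0 < m → m ≤ N i → ellTheta p (q ^ m * t i * (t j)⁻¹) ≠ 0 :=
    fun i j m h1 h2 => by
      lift m to ℕ using h1.le
      obtain ⟨k, rfl⟩ := Nat.exists_eq_add_of_lt (Int.natCast_pos.1 h1)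
      convert ellTheta_ne_zero_of_ellFac (h3 i j) (k := k) (by omega) using 2
      rw [zpow_natCast]
      ring
  rcases lt_trichotomy m 0 with h0 | rfl | h0
  · exact hflip (hpos j i _ (by omega) (by omega))
  · have hij : i ≠ j := by simpa using h
    rcases hij.lt_or_gt with hlt | hlt
    · simpa using h2 i j hlt
    · refine hflip ?_
      simpa using h2 j i hlt
  · exact hpos i j m h0 hm'

variable {T A : ℂ → ℂ} {b : Fin 3 → ℂ → ℂ} {u : ℂ}

theorem continuousAt_multTerm (hp : ‖p‖ < 1) (hq : q ≠ 0) (ht : ∀ i, t i ≠ 0)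
    (hTc : ContinuousAt T u) (hAc : ContinuousAt A u) (hbc : ∀ j, ContinuousAt (b j) u)
    (hT : T u ≠ 0) (hA : A u ≠ 0) (hb : ∀ j, b j u ≠ 0) (hK : K = ∑ i, N i)
    (h1 : ∀ i, ellTheta p (T u * t i) ≠ 0)
    (h3 : ∀ i j, ellFac p q (q * t i * (t j)⁻¹) (N i) ≠ 0)
    (h4 : ∀ i j, ellFac p q (q ^ (1 - (K : ℤ)) * (A u)⁻¹ * t i * t j) (N i) ≠ 0)
    (h5 : ∀ j, ellFac p q (q * T u * (b j u)⁻¹) K ≠ 0)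
    (h6 : ∀ i, ellFac p q (q ^ (N i + 1) * T u * t i) K ≠ 0)
    (h7 : ∀ i, ellFac p q (q ^ K * A u * T u * (t i)⁻¹) (K - N i) ≠ 0)
    {l : Fin n → ℕ} (hl : l ≤ N) :
    ContinuousAt (fun v => multTerm p q (T v) (A v) t (fun j => b j v) N K l) u := by
  have hs : ∑ i, l i ≤ K := hK ▸ Finset.sum_le_sum fun i _ => hl i
  have hsub : ∀ i, ∑ k, l k - l i ≤ K - N i := fun i => by
    rw [hK, ← Finset.add_sum_erase _ l (Finset.mem_univ i),
      ← Finset.add_sum_erase _ N (Finset.mem_univ i), Nat.add_sub_cancel_left,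
      Nat.add_sub_cancel_left]
    exact Finset.sum_le_sum fun j _ => hl j
  have hti := fun i => inv_ne_zero (ht i)
  have hcA := fun i j => ((hAc.inv₀ hA).const_mul (q ^ (1 - (K : ℤ)))).mul_const (t i) |>.mul_const
    (t j)
  have hA' := fun i j => mul_ne_zero (mul_ne_zero (mul_ne_zero (zpow_ne_zero (1 - (K : ℤ)) hq)
    (inv_ne_zero hA)) (ht i)) (ht j)
  have hcAT := fun i => ((hAc.const_mul (q ^ K)).mul hTc).mul_const (t i)⁻¹
  have hAT := fun i => mul_ne_zero (mul_ne_zero (mul_ne_zero (pow_ne_zero K hq) hA) hT) (hti i)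
  have hTt := fun i => mul_ne_zero hT (ht i)
  unfold multTerm
  refine ContinuousAt.mul (ContinuousAt.mul (ContinuousAt.mul (ContinuousAt.mul ?_ ?_) ?_) ?_) ?_
  · refine tendsto_finsetProd _ fun i _ => ContinuousAt.div ?_ ?_ (h1 i)
    · exact ContinuousAt.comp (g := ellTheta p)
        (continuousAt_ellTheta hp (mul_ne_zero (hTt i) (pow_ne_zero _ hq)))
        ((hTc.mul_const _).mul_const _)
    · exact ContinuousAt.comp (g := ellTheta p) (continuousAt_ellTheta hp (hTt i))
        (hTc.mul_const _)
  · exact tendsto_finsetProd _ fun i _ => tendsto_finsetProd _ fun j _ =>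
      continuousAt_const.mul (continuousAt_ellFac hp hq (hcA i j) (hA' i j) _)
  · exact tendsto_finsetProd _ fun i _ => tendsto_finsetProd _ fun j _ =>
      continuousAt_const.div (continuousAt_const.mul
        (continuousAt_ellFac hp hq (hcA i j) (hA' i j) _)) (mul_ne_zero
          (ellFac_ne_zero_of_le (h3 i j) (hl i)) (ellFac_ne_zero_of_le (h4 i j) (hl i)))
  · refine tendsto_finsetProd _ fun j _ => ContinuousAt.div ?_ ?_
      (ellFac_ne_zero_of_le (h5 j) hs)
    · exact tendsto_finsetProd _ fun i _ => continuousAt_ellFac hp hq ((hbc j).const_mul _)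
        (mul_ne_zero (ht i) (hb j)) _
    · exact continuousAt_ellFac hp hq ((hTc.const_mul q).mul ((hbc j).inv₀ (hb j)))
        (mul_ne_zero (mul_ne_zero hq hT) (inv_ne_zero (hb j))) _
  · refine tendsto_finsetProd _ fun i _ => ContinuousAt.div (ContinuousAt.mul (ContinuousAt.mul
      ?_ ?_) continuousAt_const) (ContinuousAt.mul ?_ ?_) (mul_ne_zero
        (ellFac_ne_zero_of_le (h6 i) hs) (ellFac_ne_zero_of_le (h7 i) (hsub i)))
    · exact continuousAt_ellFac hp hq (hTc.mul_const _) (hTt i) _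
    · exact continuousAt_ellFac hp hq (hcAT i) (hAT i) _
    · exact continuousAt_ellFac hp hq ((hTc.const_mul _).mul_const _)
        (mul_ne_zero (mul_ne_zero (pow_ne_zero _ hq) hT) (ht i)) _
    · exact continuousAt_ellFac hp hq (hcAT i) (hAT i) _

theorem continuousAt_multValue (hp : ‖p‖ < 1) (hq : q ≠ 0) (ht : ∀ i, t i ≠ 0)
    (hTc : ContinuousAt T u) (hAc : ContinuousAt A u) (hbc : ∀ j, ContinuousAt (b j) u)
    (hT : T u ≠ 0) (hA : A u ≠ 0) (hb : ∀ j, b j u ≠ 0)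
    (h5 : ∀ j, ellFac p q (q * T u * (b j u)⁻¹) K ≠ 0)
    (h8 : ∀ i j, ellFac p q (A u * (t i)⁻¹ * (t j)⁻¹) K ≠ 0)
    (h9 : ∀ i j, ellFac p q (A u * (t i)⁻¹ * b j u) (K - N i) ≠ 0) :
    ContinuousAt (fun v => multValue p q (T v) (A v) t (fun j => b j v) N K) u := by
  have hti := fun i => inv_ne_zero (ht i)
  have hcA := fun i j m => continuousAt_ellFac hp hq ((hAc.mul_const (t i)⁻¹).mul_const (t j)⁻¹)
    (mul_ne_zero (mul_ne_zero hA (hti i)) (hti j)) m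
  have hcb := fun i j m => continuousAt_ellFac hp hq ((hAc.mul_const (t i)⁻¹).mul (hbc j))
    (mul_ne_zero (mul_ne_zero hA (hti i)) (hb j)) m
  unfold multValue
  refine ContinuousAt.mul (ContinuousAt.mul (ContinuousAt.mul (ContinuousAt.mul ?_ ?_) ?_) ?_) ?_
  · exact tendsto_finsetProd _ fun i _ => tendsto_finsetProd _ fun j _ =>
      (hcA i j _).div (hcA i j _) (h8 i j)
  · exact tendsto_finsetProd _ fun i _ => tendsto_finsetProd _ fun j _ =>
      (hcA i j _).div (hcA i j _) (ellFac_ne_zero_of_le (h8 i j)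
        ((Nat.sub_le _ _).trans (Nat.sub_le _ _)))
  · exact tendsto_finsetProd _ fun i _ => tendsto_finsetProd _ fun j _ =>
      (hcb i j _).div (hcb i j _) (h9 i j)
  · exact tendsto_finsetProd _ fun i _ => continuousAt_ellFac hp hq
      ((hTc.const_mul q).mul_const (t i)) (mul_ne_zero (mul_ne_zero hq hT) (ht i)) _
  · exact tendsto_finsetProd _ fun j _ => continuousAt_const.div (continuousAt_ellFac hp hq
      ((hTc.const_mul q).mul ((hbc j).inv₀ (hb j)))
        (mul_ne_zero (mul_ne_zero hq hT) (inv_ne_zero (hb j))) _) (h5 j)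

end Limit

/-! ### A one-parameter perturbation -/

section Perturbation

variable {n : ℕ} {p q T A : ℂ} {t : Fin n → ℂ} {b : Fin 3 → ℂ} {N : Fin n → ℕ} {K : ℕ}

/-- The scaling `T u`, `A u⁻²`, `b 0 * u³` preserves the relation defining `A`. The exponents are
chosen so that each argument required to be generic carries a non-zero power of `u`; then each
condition excludes only countably many `u`. -/
theorem eventually_sum_multTerm (hp : ‖p‖ < 1) (hq : q ≠ 0) (ht : ∀ i, t i ≠ 0)
    (hT0 : T ≠ 0) (hb : ∀ j, b j ≠ 0)
    (hA : A = q * T * (b 0)⁻¹ * (b 1)⁻¹ * (b 2)⁻¹) (hK : K = ∑ i, N i)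
    (hx : ∀ i j, ∀ m : ℤ, -(N j : ℤ) ≤ m → m ≤ N i → (i ≠ j ∨ m ≠ 0) →
      ellTheta p (q ^ m * t i * (t j)⁻¹) ≠ 0) :
    ∀ᶠ u : ℂ in cocountable,
      ∑ l ∈ Finset.Icc (0 : Fin n → ℕ) N, multTerm p q (T * u) (A * (u ^ 2)⁻¹) t
          (fun j => b j * u ^ (![3, 0, 0] j : ℕ)) N K l
        = multValue p q (T * u) (A * (u ^ 2)⁻¹) t (fun j => b j * u ^ (![3, 0, 0] j : ℕ)) N K := by
  have hA0 : A ≠ 0 := by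
    rw [hA]
    have := fun j => inv_ne_zero (hb j)
    exact mul_ne_zero (mul_ne_zero (mul_ne_zero (mul_ne_zero hq hT0) (this 0)) (this 1)) (this 2)
  have hti := fun i => inv_ne_zero (ht i)
  obtain ⟨B, hB⟩ : ∃ B, B = q ^ ((K : ℤ) - 1) * A := ⟨_, rfl⟩
  have hB0 : B ≠ 0 := hB ▸ mul_ne_zero (zpow_ne_zero _ hq) hA0
  have hqm := fun m : ℕ => pow_ne_zero m hq
  have hne : ∀ᶠ u : ℂ in cocountable, u ≠ 0 :=
    mem_cocountable.2 (by simp)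
  have hy : ∀ i j, ∀ m : ℕ, ∀ᶠ u : ℂ in cocountable,
      ellTheta p (t i * t j / B * q ^ m * u ^ (2 : ℤ)) ≠ 0 := fun i j m =>
    eventually_cocountable_ellTheta_ne_zero hp (mul_ne_zero (div_ne_zero (mul_ne_zero (ht i)
      (ht j)) hB0) (hqm m)) (by norm_num)
  have hT : ∀ i, ∀ m : ℕ, ∀ᶠ u : ℂ in cocountable,
      ellTheta p (T * t i * q ^ m * u ^ (1 : ℤ)) ≠ 0 := fun i m =>
    eventually_cocountable_ellTheta_ne_zero hp (mul_ne_zero (mul_ne_zero hT0 (ht i)) (hqm m))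
      (by norm_num)
  have hβ : ∀ i j, ∀ m : ℕ, ∀ᶠ u : ℂ in cocountable,
      ellTheta p (T * t i * t j / (B * b 2) * q ^ m * u ^ (3 : ℤ)) ≠ 0 := fun i j m =>
    eventually_cocountable_ellTheta_ne_zero hp (mul_ne_zero (div_ne_zero (mul_ne_zero (mul_ne_zero
      hT0 (ht i)) (ht j)) (mul_ne_zero hB0 (hb 2))) (hqm m)) (by norm_num)
  have hβT : ∀ i, ∀ m : ℕ, ∀ᶠ u : ℂ in cocountable,
      ellTheta p (t i / (B * b 2) * q ^ m * u ^ (2 : ℤ)) ≠ 0 := fun i m =>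
    eventually_cocountable_ellTheta_ne_zero hp (mul_ne_zero (div_ne_zero (ht i)
      (mul_ne_zero hB0 (hb 2))) (hqm m)) (by norm_num)
  have hTb : ∀ j, ∀ᶠ u : ℂ in cocountable,
      ellFac p q (q * T * (b j)⁻¹ * u ^ (![-2, 1, 1] j : ℤ)) K ≠ 0 := fun j =>
    eventually_cocountable_ellFac_ne_zero hp hq (mul_ne_zero (mul_ne_zero hq hT0)
      (inv_ne_zero (hb j))) (by fin_cases j <;> simp) K
  have hAT : ∀ i, ∀ᶠ u : ℂ in cocountable,
      ellFac p q (q ^ K * A * T * (t i)⁻¹ * u ^ (-1 : ℤ)) (K - N i) ≠ 0 := fun i =>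
    eventually_cocountable_ellFac_ne_zero hp hq (mul_ne_zero (mul_ne_zero (mul_ne_zero (hqm K) hA0)
      hT0) (hti i)) (by norm_num) _
  have hD : ∀ i j, ∀ᶠ u : ℂ in cocountable,
      ellFac p q (A * (t i)⁻¹ * (t j)⁻¹ * u ^ (-2 : ℤ)) K ≠ 0 := fun i j =>
    eventually_cocountable_ellFac_ne_zero hp hq (mul_ne_zero (mul_ne_zero hA0 (hti i)) (hti j))
      (by norm_num) _
  have hE : ∀ i j, ∀ᶠ u : ℂ in cocountable,
      ellFac p q (A * (t i)⁻¹ * b j * u ^ (![1, -2, -2] j : ℤ)) (K - N i) ≠ 0 := fun i j =>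
    eventually_cocountable_ellFac_ne_zero hp hq (mul_ne_zero (mul_ne_zero hA0 (hti i)) (hb j))
      (by fin_cases j <;> simp) _
  simp only [← eventually_countable_forall] at hy hT hβ hβT hTb hAT hD hE
  filter_upwards [hne, hy, hT, hβ, hβT, hTb, hAT, hD, hE] with u hu hy hT hβ hβT hTb hAT hD hE
  have e1 : ∀ j, (u ^ (![3, 0, 0] j : ℕ))⁻¹ * u = u ^ (![-2, 1, 1] j : ℤ) := fun j => by
    fin_cases j
    · simp [zpow_neg, zpow_ofNat]; field_simp
    · simp
    · simp
  have e2 : ∀ j, u ^ (![3, 0, 0] j : ℕ) * (u ^ 2)⁻¹ = u ^ (![1, -2, -2] j : ℤ) := fun j => by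
    fin_cases j
    · simp; field_simp
    · simp [zpow_neg, zpow_ofNat]
    · simp [zpow_neg, zpow_ofNat]
  refine sum_multTerm_of_generic (B := B * (u ^ 2)⁻¹) hp hq ht (mul_ne_zero hT0 hu)
    (fun j => mul_ne_zero (hb j) (pow_ne_zero _ hu)) ?_ hK ?_ hx (fun i j m => ?_) (fun i m => ?_)
    (fun i j m => ?_) (fun i m => ?_) (fun j => ?_) (fun i => ?_) (fun i j => ?_) (fun i j => ?_)
  · simp [hA]; field_simp
  · rw [hB, mul_assoc]
  · convert hy i j m using 2
    rw [zpow_ofNat]; field_simp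
  · convert hT i m using 2
    rw [zpow_one]; ring
  · convert hβ i j m using 2
    rw [zpow_ofNat]; simp; field_simp
  · convert hβT i m using 2
    rw [zpow_ofNat]; simp; field_simp
  · convert hTb j using 2
    rw [← e1, mul_inv]; ring
  · convert hAT i using 2
    rw [zpow_neg_one]; field_simp
  · convert hD i j using 2
    rw [zpow_neg, zpow_ofNat]; ring
  · convert hE i j using 2
    rw [← e2]; ring

end Perturbation

end Auxiliary

/-! ### The summation formula -/

theorem theorem4p7 (n : ℕ) (p q : ℂ) (hp : ‖p‖ < 1) (hq : ‖q‖ < 1) (hq0 : q ≠ 0)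
    (t : Fin n → ℂ) (ht : ∀ i, t i ≠ 0) (b : Fin 3 → ℂ) (hb : ∀ j, b j ≠ 0)
    (N : Fin n → ℕ) (K : ℕ) (hK : K = ∑ i, N i)
    (T : ℂ) (hT : T = ∏ i, t i)
    (A : ℂ) (hA : A = q * T * (b 0)⁻¹ * (b 1)⁻¹ * (b 2)⁻¹)
    -- no denominator vanishes, on the left for all `0 ≤ l ≤ N`:
    -- `(a)_m ≠ 0` implies `(a)_k ≠ 0` for all `k ≤ m`
    (h1 : ∀ i, ellTheta p (T * t i) ≠ 0)
    (h2 : ∀ i j, i < j → ellTheta p (t i * (t j)⁻¹) ≠ 0)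
    (h3 : ∀ i j, ellFac p q (q * t i * (t j)⁻¹) (N i) ≠ 0)
    (h4 : ∀ i j, ellFac p q (q ^ (1 - (K : ℤ)) * A⁻¹ * t i * t j) (N i) ≠ 0)
    (h5 : ∀ j, ellFac p q (q * T * (b j)⁻¹) K ≠ 0)
    (h6 : ∀ i, ellFac p q (q ^ (N i + 1) * T * t i) K ≠ 0)
    (h7 : ∀ i, ellFac p q (q ^ K * A * T * (t i)⁻¹) (K - N i) ≠ 0)
    (h8 : ∀ i j, ellFac p q (A * (t i)⁻¹ * (t j)⁻¹) K ≠ 0)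
    (h9 : ∀ i j, ellFac p q (A * (t i)⁻¹ * b j) (K - N i) ≠ 0) :
    ∑ l ∈ Finset.Icc (0 : Fin n → ℕ) N,
      (∏ i, ellTheta p (T * t i * q ^ (l i + ∑ k, l k)) / ellTheta p (T * t i)) *
      (∏ i, ∏ j ∈ Finset.Ioi i,
        ellTheta p (q ^ ((l i : ℤ) - (l j : ℤ)) * t i * (t j)⁻¹) / ellTheta p (t i * (t j)⁻¹) *
          ellFac p q (q ^ (1 - (K : ℤ)) * A⁻¹ * t i * t j) (l i + l j)) *
      (∏ i, ∏ j, ellFac p q (q ^ (-(N j : ℤ)) * t i * (t j)⁻¹) (l i) /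
        (ellFac p q (q * t i * (t j)⁻¹) (l i) *
          ellFac p q (q ^ (1 - (K : ℤ)) * A⁻¹ * t i * t j) (l i))) *
      (∏ j, (∏ i, ellFac p q (t i * b j) (l i)) / ellFac p q (q * T * (b j)⁻¹) (∑ k, l k)) *
      (∏ i, ellFac p q (T * t i) (∑ k, l k) *
          ellFac p q (q ^ K * A * T * (t i)⁻¹) (∑ k, l k) * q ^ (((i : ℕ) + 1) * l i) /
        (ellFac p q (q ^ (N i + 1) * T * t i) (∑ k, l k) *
          ellFac p q (q ^ K * A * T * (t i)⁻¹) ((∑ k, l k) - l i)))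
    = (∏ i, ∏ j, ellFac p q (A * (t i)⁻¹ * (t j)⁻¹) (K - N i) /
          ellFac p q (A * (t i)⁻¹ * (t j)⁻¹) K) *
      (∏ i, ∏ j ∈ Finset.Ioi i, ellFac p q (A * (t i)⁻¹ * (t j)⁻¹) K /
          ellFac p q (A * (t i)⁻¹ * (t j)⁻¹) (K - N i - N j)) *
      (∏ i, ∏ j, ellFac p q (A * (t i)⁻¹ * b j) K /
          ellFac p q (A * (t i)⁻¹ * b j) (K - N i)) *
      (∏ i, ellFac p q (q * T * t i) (N i)) *
      (∏ j, 1 / ellFac p q (q * T * (b j)⁻¹) K) := by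
  have hT0 : T ≠ 0 := hT ▸ Finset.prod_ne_zero_iff.2 fun i _ => ht i
  have hA0 : A ≠ 0 := by
    rw [hA]
    have := fun j => inv_ne_zero (hb j)
    exact mul_ne_zero (mul_ne_zero (mul_ne_zero (mul_ne_zero hq0 hT0) (this 0)) (this 1)) (this 2)
  have hTc : ContinuousAt (fun u => T * u) 1 := continuousAt_id.const_mul T
  have hAc : ContinuousAt (fun u => A * (u ^ 2)⁻¹) 1 :=
    ((continuousAt_id.pow 2).inv₀ (by simp)).const_mul A
  have hbc : ∀ j, ContinuousAt (fun u => b j * u ^ (![3, 0, 0] j : ℕ)) 1 := fun j =>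
    (continuousAt_id.pow _).const_mul (b j)
  have eT : T * 1 = T := mul_one T
  have eA : A * (1 ^ 2)⁻¹ = A := by simp
  have eb : ∀ j, b j * 1 ^ (![3, 0, 0] j : ℕ) = b j := fun j => by rw [one_pow, mul_one]
  have hL : ContinuousAt (fun u => ∑ l ∈ Finset.Icc (0 : Fin n → ℕ) N, multTerm p q (T * u)
      (A * (u ^ 2)⁻¹) t (fun j => b j * u ^ (![3, 0, 0] j : ℕ)) N K l) 1 := by
    refine tendsto_finsetSum _ fun l hl => continuousAt_multTerm hp hq0 ht hTc hAc hbc ?_ ?_ ?_ hK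
      ?_ h3 ?_ ?_ ?_ ?_ (Finset.mem_Icc.1 hl).2
    all_goals simpa only [eT, eA, eb]
  have hR : ContinuousAt (fun u => multValue p q (T * u) (A * (u ^ 2)⁻¹) t
      (fun j => b j * u ^ (![3, 0, 0] j : ℕ)) N K) 1 := by
    refine continuousAt_multValue hp hq0 ht hTc hAc hbc ?_ ?_ ?_ ?_ ?_ ?_
    all_goals simpa only [eT, eA, eb]
  have hev := eventually_sum_multTerm (p := p) (T := T) hp hq0 ht hT0 hb hA hK
    (ellTheta_zpow_mul_div_ne_zero hp hq0 ht h2 h3)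
  -- Both sides are continuous at `u = 1` and agree for all but countably many `u`, so they agree at
  -- `1`.
  have key := tendsto_nhds_unique_of_eventuallyEq (hL.tendsto.mono_left inf_le_left)
    (hR.tendsto.mono_left inf_le_left) (hev.filter_mono (inf_le_right (a := nhds 1)))
  simp only [eT, eA, eb] at key
  exact key
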